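/- Let $k$ be a field of characteristic zero and let $A$ be a connected finite dimensional $k$-algebra that is basic, i.e. $A/\operatorname{rad}A$ is isomorphic to a finite product of copies of $k$. Fix a complete system $(e_x)_{x\in Q_0}$ of primitive orthogonal idempotents of $A$, and let $Q$ be the ordinary quiver of $A$: its set of vertices is $Q_0$ and the number of arrows $x\to y$ is $\dim_k e_y(\operatorname{rad}A)e_x/e_y(\operatorname{rad}A)^2e_x$. A bypass in $Q$ is a pair $(\alpha,u)$ where $\alpha$ is an arrow and $u\neq\alpha$ is a path parallel to $\alpha$. Assume that $Q$ has no double bypass, i.e. there are no bypasses $(\alpha,u)$ and $(\beta,v)$ such that $\beta$ appears in $u$. Let $kQ$ be the path category of $Q$. An ideal $I$ of $kQ$ is admissible if every element of $I$ is a combination of paths of length at least $2$ and $I$ contains all sufficiently long paths. An admissible presentation of $A$ is an isomorphism $kQ/I\simeq A$, with $I$ admissible, that sends the trivial path at $x$ to $e_x$ for each $x\in Q_0$ (an isomorphism of $k$-categories that is the identity on objects, where $A$ has the objects $x \in Q_0$ and the morphism spaces $e_yAe_x$). A minimal relation of $I$ is a nonzero $r=\sum_{i=1}^n t_iu_i\in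 I$ ($t_i\in k^*$, the $u_i$ distinct parallel paths) such that $\sum_{i\in E}t_iu_i\notin I$ for every nonempty proper subset $E\subset\{1,\dots,n\}$. The homotopy relation $\sim_I$ is the smallest equivalence relation on the walks of $Q$ that is compatible with concatenation and such that $\alpha\alpha^{-1}\sim_I e_y$ and $\alpha^{-1}\alpha\sim_I e_x$ for every arrow $\alpha\colon x\to y$, and $u\sim_I v$ whenever $u$ and $v$ appear in a common minimal relation of $I$. For a bypass $(\alpha,u)$ and $\tau\in k$, the transvection $\varphi_{\alpha,u,\tau}\colon kQ\to kQ$ is the $k$-linear functor that fixes the vertices and all the arrows other than $\alpha$, and sends $\alpha$ to $\alpha+\tau u$. Let $\Gamma$ be the quiver whose vertices are the homotopy relations $\sim_I$ of the admissible presentations $kQ/I\simeq A$, with exactly one arrow $\sim\to\sim'$ if $\sim'$ is a direct successor of $\sim$, and none otherwise. Here $\sim'$ is a direct successor of $\sim$ if there exist admissible ideals $I,J$ of $kQ$ and a transvection $\varphi_{\alpha,u,\tau}$ such that $\sim\,=\,\sim_I$, $\sim'\,=\,\sim_J$, $J=\varphi_{\alpha,u,\tau}(I)$, $\alpha\not\sim_I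 u$ and $\alpha\sim_J u$. Then $\Gamma$ is finite and has exactly one source, that is, exactly one vertex at which no arrow ends. -/

import Mathlib

universe u v w z

noncomputable section

/-! ## The path category `kQ` and its ideals

A quiver `Q` is a type `V` of vertices with a `Quiver V` structure. Paths are composed from left
to right, so that the product written `β α` with functions on the left is `α.comp β` here. -/

/-- The space of morphisms `x → y` in the path category `kQ`: it has the oriented paths from `x`
to `y` (the trivial one included) as a basis. -/
abbrev PathHom (k : Type w) [Field k] {V : Type u} [Quiver.{v} V] (x y : V) : Type (max u v w) :=
  Quiver.Path x y →₀ k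

namespace PathHom

variable {k : Type w} [Field k] {V : Type u} [Quiver.{v} V]

/-- Composition in `kQ`: the bilinear extension of the concatenation of paths. -/
def comp {x y z : V} (f : PathHom k x y) (g : PathHom k y z) : PathHom k x z :=
  f.sum fun p s => g.sum fun q t => Finsupp.single (p.comp q) (s * t)

/-- The `k`-linear functor `kQ → kQ` that is the identity on the vertices and is given by `F` on
the arrows, evaluated at a path. -/
def onPath (F : ∀ a : (Σ x y : V, x ⟶ y), PathHom k a.1 a.2.1) {x : V} :
    ∀ {y : V}, Quiver.Path x y → PathHom k x y
  | _, Quiver.Path.nil => Finsupp.single Quiver.Path.nil 1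
  | _, Quiver.Path.cons p β => comp (onPath F p) (F ⟨_, _, β⟩)

/-- The `k`-linear functor `kQ → kQ` that is the identity on the vertices and is given by `F` on
the arrows, as a linear map on each space of morphisms. -/
def functorOfArrows (F : ∀ a : (Σ x y : V, x ⟶ y), PathHom k a.1 a.2.1) (x y : V) :
    PathHom k x y →ₗ[k] PathHom k x y :=
  Finsupp.linearCombination k (onPath F)

open Classical in
/-- The functor `φ_{α,u,τ} : kQ → kQ`: it fixes the vertices, sends the arrow `α` to `α + τ u` and
fixes every other arrow. -/
def transvection {a b : V} (α : a ⟶ b) (u : Quiver.Path a b) (τ : k) (x y : V) :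
    PathHom k x y →ₗ[k] PathHom k x y :=
  functorOfArrows
    (Function.update (fun c : (Σ x y : V, x ⟶ y) => Finsupp.single c.2.2.toPath (1 : k)) ⟨a, b, α⟩
      (Finsupp.single α.toPath 1 + τ • Finsupp.single u 1)) x y

end PathHom

/-- An ideal of the `k`-category `kQ`. -/
structure PathIdeal (k : Type w) [Field k] (V : Type u) [Quiver.{v} V] where
  /-- The subspace of the morphisms `x → y` that lie in the ideal. -/
  hom : ∀ x y : V, Submodule k (PathHom k x y)
  comp_mem_left : ∀ {x y z : V} (f : PathHom k x y) (g : PathHom k y z),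
    f ∈ hom x y → f.comp g ∈ hom x z
  comp_mem_right : ∀ {x y z : V} (f : PathHom k x y) (g : PathHom k y z),
    g ∈ hom y z → f.comp g ∈ hom x z

namespace PathIdeal

variable {k : Type w} [Field k] {V : Type u} [Quiver.{v} V]

/-- Admissible ideals. The square of the ideal generated by the arrows is spanned by the paths of
length at least `2`, so the first condition says that the ideal lies in that square. -/
structure IsAdmissible (I : PathIdeal k V) : Prop where
  two_le_length : ∀ {x y : V}, ∀ r ∈ I.hom x y, ∀ p ∈ r.support, 2 ≤ p.length
  exists_length : ∀ x : V, ∃ n : ℕ, 2 ≤ n ∧ ∀ y : V,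
    (∀ p : Quiver.Path x y, n ≤ p.length → Finsupp.single p (1 : k) ∈ I.hom x y) ∧
    (∀ p : Quiver.Path y x, n ≤ p.length → Finsupp.single p (1 : k) ∈ I.hom y x)

/-- Minimal relations: nonzero elements of the ideal such that no nonempty proper part of the
normal form lies in the ideal. -/
def IsMinimalRelation (I : PathIdeal k V) {x y : V} (r : PathHom k x y) : Prop :=
  r ∈ I.hom x y ∧ r ≠ 0 ∧ ∀ E : Finset (Quiver.Path x y), E.Nonempty → E ⊂ r.support →
    ∑ p ∈ E, Finsupp.single p (r p) ∉ I.hom x y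

end PathIdeal

/-! ## Walks and the homotopy relation -/

/-- Walks from `x` to `y`: paths made of arrows and formal inverses of arrows. -/
abbrev QuiverWalk {V : Type u} [Quiver.{v} V] (x y : V) : Type (max u v) :=
  Quiver.Path (V := Quiver.Symmetrify V) x y

/-- Relations between parallel walks. -/
abbrev WalkRel (V : Type u) [Quiver.{v} V] : Type (max u v) :=
  ∀ x y : V, QuiverWalk x y → QuiverWalk x y → Prop

/-- An oriented path, seen as a walk. -/
def QuiverWalk.ofPath {V : Type u} [Quiver.{v} V] {x : V} :
    ∀ {y : V}, Quiver.Path x y → QuiverWalk x y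
  | _, Quiver.Path.nil => Quiver.Path.nil
  | _, Quiver.Path.cons p α => Quiver.Path.cons (ofPath p) (Quiver.Hom.toPos α)

/-- The homotopy relation `∼_I`: the smallest equivalence relation on walks that is compatible
with concatenation, cancels an arrow against its inverse, and identifies any two paths that appear
in the same minimal relation. -/
inductive HomotopyRel {k : Type w} [Field k] {V : Type u} [Quiver.{v} V]
    (I : PathIdeal k V) : WalkRel V
  | refl {x y : V} (p : QuiverWalk x y) : HomotopyRel I x y p p
  | symm {x y : V} {p q : QuiverWalk x y} : HomotopyRel I x y p q → HomotopyRel I x y q p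
  | trans {x y : V} {p q r : QuiverWalk x y} :
      HomotopyRel I x y p q → HomotopyRel I x y q r → HomotopyRel I x y p r
  | comp {x y z : V} {p p' : QuiverWalk x y} {q q' : QuiverWalk y z} :
      HomotopyRel I x y p p' → HomotopyRel I y z q q' →
      HomotopyRel I x z (p.comp q) (p'.comp q')
  | arrow_inv {x y : V} (α : x ⟶ y) :
      HomotopyRel I x x
        ((Quiver.Path.cons Quiver.Path.nil (Quiver.Hom.toPos α)).cons (Quiver.Hom.toNeg α))
        Quiver.Path.nil
  | inv_arrow {x y : V} (α : x ⟶ y) :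
      HomotopyRel I y y
        ((Quiver.Path.cons Quiver.Path.nil (Quiver.Hom.toNeg α)).cons (Quiver.Hom.toPos α))
        Quiver.Path.nil
  | minimal {x y : V} (r : PathHom k x y) (hr : I.IsMinimalRelation r) (p q : Quiver.Path x y)
      (hp : p ∈ r.support) (hq : q ∈ r.support) :
      HomotopyRel I x y (QuiverWalk.ofPath p) (QuiverWalk.ofPath q)

/-! ## Bypasses and direct successors -/

/-- A bypass is an arrow `α` together with a parallel path `u ≠ α`. -/
def IsBypass {V : Type u} [Quiver.{v} V] {x y : V} (α : x ⟶ y) (u : Quiver.Path x y) : Prop :=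
  u ≠ α.toPath

/-- The arrow `β` appears in the path `u`. -/
def ArrowAppears {V : Type u} [Quiver.{v} V] {x y z t : V} (β : z ⟶ t) (u : Quiver.Path x y) :
    Prop :=
  ∃ (p : Quiver.Path x z) (q : Quiver.Path t y), u = (p.cons β).comp q

/-- There are no two bypasses `(α, u)` and `(β, v)` such that `β` appears in `u`. -/
def NoDoubleBypass (V : Type u) [Quiver.{v} V] : Prop :=
  ∀ {x y : V} (α : x ⟶ y) (u : Quiver.Path x y), IsBypass α u →
    ∀ {z t : V} (β : z ⟶ t) (v : Quiver.Path z t), IsBypass β v → ¬ ArrowAppears β u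

/-- `S` is a direct successor of `R`: there are admissible ideals `I`, `J` of `kQ` and a
transvection `φ_{α,u,τ}` with `R = ∼_I`, `S = ∼_J`, `J = φ_{α,u,τ}(I)`, `α ≁_I u`, `α ∼_J u`. -/
def IsDirectSuccessor (k : Type w) [Field k] {V : Type u} [Quiver.{v} V]
    (R S : WalkRel V) : Prop :=
  ∃ (I J : PathIdeal k V) (a b : V) (α : a ⟶ b) (u : Quiver.Path a b) (τ : k),
    I.IsAdmissible ∧ J.IsAdmissible ∧ R = HomotopyRel I ∧ S = HomotopyRel J ∧
    IsBypass α u ∧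
    (∀ x y : V, J.hom x y = (I.hom x y).map (PathHom.transvection α u τ x y)) ∧
    ¬ HomotopyRel I a b (QuiverWalk.ofPath α.toPath) (QuiverWalk.ofPath u) ∧
    HomotopyRel J a b (QuiverWalk.ofPath α.toPath) (QuiverWalk.ofPath u)

/-! ## Algebras, their ordinary quivers and their presentations -/

section Algebras

variable (k : Type w) [Field k] {A : Type z} [Ring A] [Algebra k A]

/-- `A` is basic: `A / rad A` is a finite product of copies of `k`. -/
def IsBasicAlgebra (A : Type z) [Ring A] [Algebra k A] : Prop :=
  ∃ n : ℕ, Nonempty ((A ⧸ Ring.jacobson A) ≃ₐ[k] (Fin n → k))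

/-- An idempotent `e ≠ 0` that is not the sum of two nonzero orthogonal idempotents. -/
def IsPrimitiveIdempotent (e : A) : Prop :=
  IsIdempotentElem e ∧ e ≠ 0 ∧ ∀ f g : A, IsIdempotentElem f → IsIdempotentElem g →
    f * g = 0 → g * f = 0 → e = f + g → f = 0 ∨ g = 0

variable {V : Type u}

/-- The subspace `e_y M e_x` of `A`. -/
def cornerOf (e : V → A) (x y : V) (M : Submodule k A) : Submodule k A :=
  M.map ((LinearMap.mulLeft k (e y)).comp (LinearMap.mulRight k (e x)))

/-- The space `e_y A e_x` of morphisms `x → y` of `A`, seen as a `k`-category whose set of objects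
is the set `V` of indices of the idempotents `e`. -/
abbrev corner (e : V → A) (x y : V) : Submodule k A := cornerOf k e x y ⊤

/-- The radical of `A`, as a subspace. -/
def radical (A : Type z) [Ring A] [Algebra k A] : Submodule k A :=
  (Ring.jacobson A).restrictScalars k

/-- The `k`-category attached to `A` and the idempotents `e` is nonempty and connected. -/
def IsConnectedCategory (e : V → A) : Prop :=
  Nonempty V ∧ ∀ x y : V, Relation.EqvGen (fun x y => corner k e x y ≠ ⊥) x y

/-- `Q` (with set of vertices `V`) is the ordinary quiver of `A`, where the vertices index the
complete system `e` of primitive orthogonal idempotents: the number of arrows `x → y` is the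
dimension of `e_y (rad A) e_x / e_y (rad A)² e_x`. -/
structure IsOrdinaryQuiver [Fintype V] [Quiver.{v} V] (e : V → A) : Prop where
  complete : CompleteOrthogonalIdempotents e
  primitive : ∀ x : V, IsPrimitiveIdempotent (e x)
  finite_hom : ∀ x y : V, Finite (x ⟶ y)
  card_hom : ∀ x y : V, Nat.card (x ⟶ y) =
    Module.finrank k
      (cornerOf k e x y (radical k A) ⧸
        (cornerOf k e x y (radical k A ^ 2)).submoduleOf (cornerOf k e x y (radical k A)))

variable {k}

/-- A presentation of `A` by the ideal `I` of `kQ`: an isomorphism of `k`-categories `kQ / I ≅ A`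
that is the identity on objects, where the objects of `A` are the idempotents `e x`. -/
structure Presentation [Quiver.{v} V] (e : V → A) (I : PathIdeal k V) where
  /-- The isomorphism on the spaces of morphisms. -/
  equiv : ∀ x y : V, (PathHom k x y ⧸ I.hom x y) ≃ₗ[k] corner k e x y
  map_id : ∀ x : V,
    (equiv x x (Submodule.Quotient.mk (Finsupp.single Quiver.Path.nil 1)) : A) = e x
  map_comp : ∀ {x y z : V} (f : PathHom k x y) (g : PathHom k y z),
    (equiv x z (Submodule.Quotient.mk (f.comp g)) : A) =
      equiv y z (Submodule.Quotient.mk g) * equiv x y (Submodule.Quotient.mk f)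

variable (k)

/-- The vertices of the quiver `Γ`: the homotopy relations `∼_I` of the admissible presentations
`kQ / I ≅ A`. -/
def HomotopyQuiver [Quiver.{v} V] (e : V → A) : Type (max u v) :=
  {R : WalkRel V //
    ∃ I : PathIdeal k V, I.IsAdmissible ∧ Nonempty (Presentation e I) ∧ R = HomotopyRel I}

/-- The arrows of `Γ`: there is one arrow from `R` to `S` if `S` is a direct successor of `R`, and
none otherwise. -/
instance HomotopyQuiver.instQuiver [Quiver.{v} V] (e : V → A) :
    Quiver.{0} (HomotopyQuiver k e) where
  Hom R S := PLift (IsDirectSuccessor k R.1 S.1)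

end Algebras

/-- A source of a quiver: a vertex at which no arrow ends. -/
def IsQuiverSource {W : Type u} [Quiver.{v} W] (x : W) : Prop :=
  ∀ y : W, IsEmpty (y ⟶ x)

end

/-! Without double bypasses `Q` has neither oriented cycles nor parallel arrows, hence only finitely
many paths. Moreover every arrow of `u` in a bypass `(α, u)` is rigid: it is the only path between
its endpoints. So a functor `β ↦ β + t β`, with `t β` a combination of bypasses of `β`, fixes all
these bypasses, and such functors compose by adding the families `t` (`functorOfArrows_unip_unip`).
In characteristic zero each is the exponential of the derivation `β ↦ t β`.

An ideal `I` is stable under the projections onto the classes of `∼_I`, and `∼_I` is contained in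
every `∼_J` for which `I` has this stability. It follows that `∼_I` is determined by its restriction
to oriented paths, so `Γ` is finite. A functor respecting the classes of `∼_J` can only refine `∼_J`
by inverse image; hence arrows of `Γ` go from a strictly finer to a coarser relation, and a minimal
vertex is a source. Vertices exist by Gabriel's theorem (`exists_isPresentationKernel`).

For uniqueness, let `∼_I` and `∼_J` be sources. Up to a dilatation, which does not affect homotopy,
`J` is the inverse image of `I` under `β ↦ β + t β`. At a source, a transvection along a homotopic
bypass cannot change the relation, since otherwise it would give an arrow ending there. Moving `I`
and `J` by such transvections removes from `t` all bypasses homotopic for one of the two relations.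
The remaining derivation has no component inside a class of either relation, and
`map_mem_of_isHomogeneousFor` shows that it stabilises the ideal. Its exponential then does so too,
and the two ideals coincide. -/

noncomputable section

/-! ## Commuting gradings and nilpotent perturbations of homogeneous subspaces -/

section HomogeneousSubspaces

variable {k : Type w} [Field k] {P : Type u}

open Classical in
/-- The coordinate projection of `P →₀ k` onto the span of the elements satisfying `C`. -/
def coordPart (C : P → Prop) : (P →₀ k) →ₗ[k] (P →₀ k) where
  toFun f := f.filter C
  map_add' _ _ := Finsupp.filter_add
  map_smul' _ _ := Finsupp.filter_smul

open Classical in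
theorem coordPart_apply (C : P → Prop) (f : P →₀ k) (p : P) :
    coordPart C f p = if C p then f p else 0 := by
  simp [coordPart, Finsupp.filter_apply]

theorem coordPart_comm (C D : P → Prop) (f : P →₀ k) :
    coordPart C (coordPart D f) = coordPart D (coordPart C f) := by
  ext p
  by_cases hC : C p <;> by_cases hD : D p <;> simp [coordPart_apply, hC, hD]

theorem coordPart_eq_self {C : P → Prop} {f : P →₀ k} (h : ∀ p, f p ≠ 0 → C p) :
    coordPart C f = f := by
  ext p
  by_cases hC : C p
  · simp [coordPart_apply, hC]
  · have : f p = 0 := by_contra fun h0 => hC (h p h0)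
    simp [coordPart_apply, hC, this]

theorem coordPart_eq_zero {C : P → Prop} {f : P →₀ k} (h : ∀ p, f p ≠ 0 → ¬ C p) :
    coordPart C f = 0 := by
  ext p
  by_cases hC : C p
  · have : f p = 0 := by_contra fun h0 => h p h0 hC
    simp [coordPart_apply, hC, this]
  · simp [coordPart_apply, hC]

theorem coordPart_idem (C : P → Prop) (f : P →₀ k) :
    coordPart C (coordPart C f) = coordPart C f :=
  coordPart_eq_self fun p hp => by
    by_contra hC
    simp [coordPart_apply, hC] at hp

theorem exists_of_map_apply_ne_zero {L : (P →₀ k) →ₗ[k] (P →₀ k)} {f : P →₀ k} {q : P}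
    (h : L f q ≠ 0) : ∃ p, f p ≠ 0 ∧ L (Finsupp.single p 1) q ≠ 0 := by
  by_contra! hc
  apply h
  have hf : L f = ∑ p ∈ f.support, f p • L (Finsupp.single p 1) := by
    conv_lhs => rw [← Finsupp.sum_single f]
    rw [Finsupp.sum, map_sum]
    refine Finset.sum_congr rfl fun p _ => ?_
    rw [← map_smul, Finsupp.smul_single, smul_eq_mul, mul_one]
  rw [hf, Finsupp.finsetSum_apply]
  refine Finset.sum_eq_zero fun p hp => ?_
  rw [Finsupp.smul_apply, hc p (Finsupp.mem_support_iff.1 hp), smul_zero]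

/-- The span of the elements of weight less than `j`. -/
def weightLT (k : Type w) [Field k] (n : P → ℕ) (j : ℕ) : Submodule k (P →₀ k) :=
  Finsupp.supported k k {p | n p < j}

theorem mem_weightLT {n : P → ℕ} {j : ℕ} {f : P →₀ k} :
    f ∈ weightLT k n j ↔ ∀ p, f p ≠ 0 → n p < j := by
  simp [weightLT, Finsupp.mem_supported, Set.subset_def]

theorem weightLT_mono {n : P → ℕ} {i j : ℕ} (h : i ≤ j) : weightLT k n i ≤ weightLT k n j :=
  fun _ hf => mem_weightLT.2 fun p hp => (mem_weightLT.1 hf p hp).trans_le h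

theorem coordPart_mem_weightLT {n : P → ℕ} {j : ℕ} {f : P →₀ k} (C : P → Prop)
    (hf : f ∈ weightLT k n j) : coordPart C f ∈ weightLT k n j :=
  mem_weightLT.2 fun p hp => mem_weightLT.1 hf p fun h0 => hp (by simp [coordPart_apply, h0])

/-- A subspace is homogeneous for a partition of the basis if it is stable under the projections
onto the parts. -/
def IsHomogeneousFor (s : P → P → Prop) (M : Submodule k (P →₀ k)) : Prop :=
  ∀ f ∈ M, ∀ p, coordPart (fun q => s q p) f ∈ M

/-- If `M` is homogeneous for `s` and its image `N` under a unipotent map `φ = 1 + ν + ⋯` is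
homogeneous for `t`, where `ν` strictly lowers the weight and has no diagonal component
for `s` nor for `t`, then `ν` stabilises `M`. -/
theorem map_mem_of_isHomogeneousFor {s t : P → P → Prop} (hs : Equivalence s) (ht : Equivalence t)
    (n : P → ℕ) {ν φ φ' : (P →₀ k) →ₗ[k] (P →₀ k)}
    (hn : ∀ p q, ν (Finsupp.single p 1) q ≠ 0 → n q < n p)
    (hνs : ∀ p q, ν (Finsupp.single p 1) q ≠ 0 → ¬ s q p)
    (hνt : ∀ p q, ν (Finsupp.single p 1) q ≠ 0 → ¬ t q p)
    (hφ : ∀ (f : P →₀ k) (L : Submodule k (P →₀ k)), (∀ g ∈ L, ν g ∈ L) → ν (ν f) ∈ L →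
      φ f - f - ν f ∈ L)
    (hφ' : ∀ (f : P →₀ k) (L : Submodule k (P →₀ k)), (∀ g ∈ L, ν g ∈ L) → ν (ν f) ∈ L →
      φ' f - f + ν f ∈ L)
    (hright : ∀ f, φ (φ' f) = f)
    {M N : Submodule k (P →₀ k)} (hM : IsHomogeneousFor s M) (hN : IsHomogeneousFor t N)
    (hMN : ∀ f, f ∈ M ↔ φ f ∈ N) : ∀ f ∈ M, ν f ∈ M := by
  have hlow : ∀ j, ∀ f ∈ weightLT k n (j + 1), ν f ∈ weightLT k n j := by
    intro j f hf
    refine mem_weightLT.2 fun q hq => ?_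
    obtain ⟨p, hp, hpq⟩ := exists_of_map_apply_ne_zero hq
    have h1 := mem_weightLT.1 hf p hp
    have h2 := hn p q hpq
    omega
  have hstab : ∀ j, ∀ f ∈ weightLT k n j, ν f ∈ weightLT k n j := fun j f hf =>
    hlow j f (weightLT_mono (Nat.le_succ j) hf)
  -- The hypotheses `hφ` and `hφ'` state `φ = exp ν` and `φ' = exp (-ν)` up to order two, modulo any
  -- `ν`-stable `L`. Here `L` is a step of the weight filtration.
  have hφlow : ∀ j, ∀ f ∈ weightLT k n (j + 1), φ f - f ∈ weightLT k n j := by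
    intro j f hf
    have h1 := hφ f _ (hstab j) (hstab j _ (hlow j f hf))
    have := add_mem h1 (hlow j f hf)
    rwa [sub_add_cancel] at this
  have hφ'low : ∀ j, ∀ f ∈ weightLT k n (j + 1), φ' f - f ∈ weightLT k n j := by
    intro j f hf
    have h1 := hφ' f _ (hstab j) (hstab j _ (hlow j f hf))
    have := sub_mem h1 (hlow j f hf)
    rwa [add_sub_cancel_right] at this
  have hφ'stab : ∀ j, ∀ f ∈ weightLT k n j, φ' f ∈ weightLT k n j := by
    intro j f hf
    have h1 := hφ' f _ (hstab j) (hstab j _ (hstab j f hf))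
    have := add_mem (sub_mem h1 (hstab j f hf)) hf
    rwa [add_sub_cancel_right, sub_add_cancel] at this
  have hφstab : ∀ j, ∀ f ∈ weightLT k n j, φ f ∈ weightLT k n j := by
    intro j f hf
    have h1 := hφ f _ (hstab j) (hstab j _ (hstab j f hf))
    have := add_mem (add_mem h1 (hstab j f hf)) hf
    rwa [sub_add_cancel, sub_add_cancel] at this
  suffices H : ∀ m, ∀ f ∈ M, f ∈ weightLT k n m → ν f ∈ M by
    intro f hf
    refine H (f.support.sup n + 1) f hf (mem_weightLT.2 fun p hp => ?_)
    exact Nat.lt_succ_of_le (Finset.le_sup (f := n) (Finsupp.mem_support_iff.2 hp))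
  intro m
  induction m with
  | zero =>
    intro f _ hf
    have : f = 0 := by
      ext p
      by_contra h0
      exact absurd (mem_weightLT.1 hf p h0) (Nat.not_lt_zero _)
    rw [this, map_zero]
    exact zero_mem _
  | succ m ih =>
    -- the part of `M` of weight less than `m`
    set K := M ⊓ weightLT k n m with hK
    have hKν : ∀ f ∈ K, ν f ∈ K := fun f hf => ⟨ih f hf.1 hf.2, hstab m f hf.2⟩
    -- Being `ν`-stable, `K` is stable under `φ` and `φ'`, so it is also the low-weight part of `N`.
    -- It thereby inherits homogeneity for both `s` and `t`.
    have hKN : ∀ f, f ∈ K ↔ f ∈ N ∧ f ∈ weightLT k n m := by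
      intro f
      constructor
      · intro hf
        refine ⟨?_, hf.2⟩
        have h1 := hφ' f K hKν (hKν _ (hKν f hf))
        have h2 := add_mem (sub_mem h1 (hKν f hf)) hf
        rw [add_sub_cancel_right, sub_add_cancel] at h2
        have := (hMN _).1 h2.1
        rwa [hright] at this
      · intro hf
        have h0 : φ' f ∈ K := ⟨(hMN _).2 (by rw [hright]; exact hf.1), hφ'stab m f hf.2⟩
        have h1 := hφ (φ' f) K hKν (hKν _ (hKν _ h0))
        have h2 := add_mem (add_mem h1 (hKν _ h0)) h0
        rwa [sub_add_cancel, sub_add_cancel, hright] at h2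
    have hKs : ∀ f ∈ K, ∀ p, coordPart (fun q => s q p) f ∈ K := fun f hf p =>
      ⟨hM f hf.1 p, coordPart_mem_weightLT _ hf.2⟩
    have hKt : ∀ f ∈ K, ∀ p, coordPart (fun q => t q p) f ∈ K := fun f hf p =>
      (hKN _).2 ⟨hN f ((hKN f).1 hf).1 p, coordPart_mem_weightLT _ hf.2⟩
    -- the case where `f` is `s`-homogeneous and its top part is `t`-homogeneous
    have special : ∀ p, ∀ f ∈ M, f ∈ weightLT k n (m + 1) → (∀ q, f q ≠ 0 → s q p) →
        (∀ q, f q ≠ 0 → n q = m → t q p) → ν f ∈ M := by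
      intro p f hfM hfm hfs hft
      set A : (P →₀ k) →ₗ[k] (P →₀ k) := coordPart fun q => s q p with hA
      set B : (P →₀ k) →ₗ[k] (P →₀ k) := coordPart fun q => t q p with hB
      have hAB : ∀ g, A (B g) = B (A g) := coordPart_comm _ _
      have hAf : A f = f := coordPart_eq_self hfs
      have hAν : A (ν f) = 0 := by
        refine coordPart_eq_zero fun q hq hqp => ?_
        obtain ⟨p', hp', hpq⟩ := exists_of_map_apply_ne_zero hq
        exact hνs p' q hpq (hs.trans hqp (hs.symm (hfs p' hp')))
      have hBν : B (ν (B f)) = 0 := by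
        refine coordPart_eq_zero fun q hq hqp => ?_
        obtain ⟨p', hp', hpq⟩ := exists_of_map_apply_ne_zero hq
        have : t p' p := by
          by_contra hc
          simp [hB, coordPart_apply, hc] at hp'
        exact hνt p' q hpq (ht.trans hqp (ht.symm this))
      -- Projecting `φ f` by `B` stays in `N` and leaves the top part unchanged, so the difference
      -- is a low-weight element of `N`, that is, an element of `K`.
      have hy : φ f - B (φ f) ∈ K := by
        rw [hKN]
        refine ⟨sub_mem ((hMN f).1 hfM) (hN _ ((hMN f).1 hfM) p), ?_⟩
        have h1 := hφlow m f hfm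
        have h2 : f - B f ∈ weightLT k n m := by
          refine mem_weightLT.2 fun q hq => ?_
          have hq0 : f q ≠ 0 := fun h0 => hq (by simp [hB, coordPart_apply, h0])
          have hlt := mem_weightLT.1 hfm q hq0
          rcases Nat.lt_succ_iff_lt_or_eq.1 hlt with h | h
          · exact h
          · exact absurd (by simp [hB, coordPart_apply, hft q hq0 h]) hq
        have h3 : φ f - B (φ f) = (φ f - f) - B (φ f - f) + (f - B f) := by
          rw [map_sub]; abel
        rw [h3]
        exact add_mem (sub_mem h1 (coordPart_mem_weightLT _ h1)) h2
      -- The error term is pushed down one weight at a time, until `weightLT k n 0 = 0` leaves `ν f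
      -- ∈ K`.
      have key : ∀ i, i ≤ m → ν f ∈ K ⊔ weightLT k n (m - i) := by
        intro i
        induction i with
        | zero =>
          intro _
          exact Submodule.mem_sup_right (hlow m f hfm)
        | succ i ihi =>
          intro hi
          have hx := ihi (by omega)
          obtain ⟨j, hj⟩ : ∃ j, m - (i + 1) = j := ⟨_, rfl⟩
          have hj1 : m - i = j + 1 := by omega
          rw [hj1] at hx
          rw [hj]
          set L := K ⊔ weightLT k n j with hL
          have hLν : ∀ g ∈ L, ν g ∈ L := by
            intro g hg
            obtain ⟨a, ha, b, hb, rfl⟩ := Submodule.mem_sup.1 hg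
            rw [map_add]
            exact add_mem (Submodule.mem_sup_left (hKν a ha)) (Submodule.mem_sup_right (hstab j b hb))
          have hLA : ∀ g ∈ L, A g ∈ L := by
            intro g hg
            obtain ⟨a, ha, b, hb, rfl⟩ := Submodule.mem_sup.1 hg
            rw [map_add]
            exact add_mem (Submodule.mem_sup_left (hKs a ha p))
              (Submodule.mem_sup_right (coordPart_mem_weightLT _ hb))
          have hLB : ∀ g ∈ L, B g ∈ L := by
            intro g hg
            obtain ⟨a, ha, b, hb, rfl⟩ := Submodule.mem_sup.1 hg
            rw [map_add]
            exact add_mem (Submodule.mem_sup_left (hKt a ha p))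
              (Submodule.mem_sup_right (coordPart_mem_weightLT _ hb))
          have hνx : ν (ν f) ∈ L := by
            obtain ⟨a, ha, b, hb, hab⟩ := Submodule.mem_sup.1 hx
            rw [← hab, map_add]
            exact add_mem (Submodule.mem_sup_left (hKν a ha)) (Submodule.mem_sup_right (hlow j b hb))
          have hd : B (φ f) - f - ν f ∈ L := by
            have h1 := sub_mem (hφ f L hLν hνx) (Submodule.mem_sup_left hy : _ ∈ L)
            convert h1 using 1
            abel
          have hBB : B (B (φ f)) = B (φ f) := coordPart_idem _ _
          -- Modulo `L`, `f + ν f` agrees with `φ f`, hence with `B (φ f)`, so `1 - B` kills it.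
          have hd' : (f - B f) + (ν f - B (ν f)) ∈ L := by
            have h1 := sub_mem (hLB _ hd) hd
            convert h1 using 1
            rw [map_sub, map_sub, hBB]
            abel
          -- `A` commutes with `B`, fixes `f` and kills `ν f`, so it separates the two summands of
          -- `hd'`.
          have hfB : f - B f ∈ L := by
            have h1 := hLA _ hd'
            rw [map_add, map_sub, map_sub, hAB, hAB, hAf, hAν, map_zero, sub_zero, add_zero] at h1
            exact h1
          -- `B` kills `ν (B f)` because `ν` has no diagonal component for `t`; thus `B (ν (f - B
          -- f)) = B (ν f)`.
          have hxB : B (ν f) ∈ L := by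
            have h1 := hLB _ (hLν _ hfB)
            rwa [map_sub, map_sub, hBν, sub_zero] at h1
          have h2 := add_mem (sub_mem hd' hfB) hxB
          rwa [add_sub_cancel_left, sub_add_cancel] at h2
      have hfin := key m le_rfl
      rw [Nat.sub_self] at hfin
      obtain ⟨a, ha, b, hb, hab⟩ := Submodule.mem_sup.1 hfin
      have hb0 : b = 0 := by
        ext q
        by_contra h0
        exact absurd (mem_weightLT.1 hb q h0) (Nat.not_lt_zero _)
      rw [← hab, hb0, add_zero]
      exact ha.1
    classical
    -- general case, by induction on the size of the top part
    have general : ∀ N₀, ∀ f ∈ M, f ∈ weightLT k n (m + 1) →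
        (f.support.filter fun q => n q = m).card ≤ N₀ → ν f ∈ M := by
      intro N₀
      induction N₀ with
      | zero =>
        intro f hf hfm hc
        refine ih f hf (mem_weightLT.2 fun q hq => ?_)
        rcases Nat.lt_succ_iff_lt_or_eq.1 (mem_weightLT.1 hfm q hq) with h | h
        · exact h
        · have := Finset.card_eq_zero.1 (Nat.le_zero.1 hc)
          exact absurd (Finset.mem_filter.2 ⟨Finsupp.mem_support_iff.2 hq, h⟩)
            (by rw [this]; exact Finset.notMem_empty _)
      | succ N₀ ihN =>
        intro f hf hfm hc
        by_cases hemp : (f.support.filter fun q => n q = m) = ∅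
        · exact ihN f hf hfm (by rw [hemp]; simp)
        obtain ⟨p, hp⟩ := Finset.nonempty_iff_ne_empty.2 hemp
        rw [Finset.mem_filter, Finsupp.mem_support_iff] at hp
        set A : (P →₀ k) →ₗ[k] (P →₀ k) := coordPart fun q => s q p with hA
        set B : (P →₀ k) →ₗ[k] (P →₀ k) := coordPart fun q => t q p with hB
        -- `g` lies in `M` and has the same top part as `B f`. Thus `A g` falls under the special
        -- case, and subtracting it from `f` removes at least the term at `p` from the top part.
        set g := φ' (B (φ f)) with hg
        have hgM : g ∈ M := (hMN g).2 (by rw [hg, hright]; exact hN _ ((hMN f).1 hf) p)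
        have hBφ : B (φ f) ∈ weightLT k n (m + 1) := coordPart_mem_weightLT _ (hφstab _ f hfm)
        have hgm : g ∈ weightLT k n (m + 1) := hφ'stab _ _ hBφ
        have hgB : g - B f ∈ weightLT k n m := by
          have h1 := hφ'low m _ hBφ
          have h2 : B (φ f - f) ∈ weightLT k n m := coordPart_mem_weightLT _ (hφlow m f hfm)
          have h3 := add_mem h1 h2
          rwa [map_sub, sub_add_sub_cancel] at h3
        have htop : ∀ q, n q = m → g q = B f q := by
          intro q hq
          by_contra hne
          have := mem_weightLT.1 hgB q (by simpa [sub_eq_zero] using hne)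
          omega
        have hAgM : A g ∈ M := hM g hgM p
        have hAgm : A g ∈ weightLT k n (m + 1) := coordPart_mem_weightLT _ hgm
        have h1 : ν (A g) ∈ M := by
          refine special p (A g) hAgM hAgm (fun q hq => ?_) fun q hq hqm => ?_
          · by_contra hc
            simp [hA, coordPart_apply, hc] at hq
          · by_contra hc
            have : A g q = 0 := by
              simp [hA, coordPart_apply, htop q hqm, hB, hc]
            exact hq this
        have h2 : ν (f - A g) ∈ M := by
          refine ihN _ (sub_mem hf hAgM) (sub_mem hfm hAgm) (Nat.lt_succ_iff.1 (lt_of_lt_of_le ?_ hc))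
          refine Finset.card_lt_card ⟨fun q hq => ?_, fun hsub => ?_⟩
          · rw [Finset.mem_filter, Finsupp.mem_support_iff] at hq ⊢
            refine ⟨fun h0 => hq.1 ?_, hq.2⟩
            simp [hA, coordPart_apply, htop q hq.2, hB, h0]
          · have := hsub (Finset.mem_filter.2 ⟨Finsupp.mem_support_iff.2 hp.1, hp.2⟩)
            rw [Finset.mem_filter, Finsupp.mem_support_iff] at this
            apply this.1
            simp [hA, coordPart_apply, htop p hp.2, hB, hs.refl p, ht.refl p]
        have := add_mem h2 h1
        rwa [← map_add, sub_add_cancel] at this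
    intro f hf hfm
    exact general _ f hf hfm le_rfl

end HomogeneousSubspaces

/-! ## The path category -/

namespace PathHom

variable {k : Type w} [Field k] {V : Type u} [Quiver.{v} V]

theorem single_comp_single {x y z : V} (p : Quiver.Path x y) (q : Quiver.Path y z) (s t : k) :
    comp (Finsupp.single p s) (Finsupp.single q t) = Finsupp.single (p.comp q) (s * t) := by
  simp [comp]

theorem add_comp {x y z : V} (f f' : PathHom k x y) (g : PathHom k y z) :
    comp (f + f') g = comp f g + comp f' g := by
  classical
  refine Finsupp.sum_add_index' (fun p => by simp [Finsupp.sum]) fun p s s' => ?_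
  simp [add_mul, Finsupp.sum_add]

theorem comp_add {x y z : V} (f : PathHom k x y) (g g' : PathHom k y z) :
    comp f (g + g') = comp f g + comp f g' := by
  classical
  simp only [comp]
  rw [← Finsupp.sum_add]
  congr 1
  funext p s
  exact Finsupp.sum_add_index' (fun q => by simp) fun q t t' => by simp [mul_add]

theorem smul_comp {x y z : V} (c : k) (f : PathHom k x y) (g : PathHom k y z) :
    comp (c • f) g = c • comp f g := by
  simp only [comp]
  rw [Finsupp.sum_smul_index fun p => by simp [Finsupp.sum], Finsupp.smul_sum]
  simp only [Finsupp.smul_sum, Finsupp.smul_single, smul_eq_mul, mul_assoc]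

theorem comp_smul {x y z : V} (c : k) (f : PathHom k x y) (g : PathHom k y z) :
    comp f (c • g) = c • comp f g := by
  simp only [comp]
  rw [Finsupp.smul_sum]
  congr 1
  funext p s
  rw [Finsupp.sum_smul_index fun q => by simp, Finsupp.smul_sum]
  simp only [Finsupp.smul_single, smul_eq_mul, mul_left_comm]

/-- Composition as a bilinear map. -/
def compBilin (k : Type w) [Field k] (x y z : V) :
    PathHom k x y →ₗ[k] PathHom k y z →ₗ[k] PathHom k x z :=
  LinearMap.mk₂ k comp add_comp smul_comp comp_add comp_smul

theorem compBilin_apply {x y z : V} (f : PathHom k x y) (g : PathHom k y z) :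
    compBilin k x y z f g = comp f g := rfl

theorem zero_comp {x y z : V} (g : PathHom k y z) : comp (0 : PathHom k x y) g = 0 := by
  simp [comp]

theorem comp_zero {x y z : V} (f : PathHom k x y) : comp f (0 : PathHom k y z) = 0 := by
  simp [comp, Finsupp.sum]

theorem comp_assoc {x y z t : V} (f : PathHom k x y) (g : PathHom k y z) (h : PathHom k z t) :
    comp (comp f g) h = comp f (comp g h) := by
  induction f using Finsupp.induction_linear with
  | zero => simp only [zero_comp]
  | add f f' hf hf' => simp only [add_comp, hf, hf']
  | single p a =>
    induction g using Finsupp.induction_linear with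
    | zero => simp only [zero_comp, comp_zero]
    | add g g' hg hg' => simp only [add_comp, comp_add, hg, hg']
    | single q b =>
      induction h using Finsupp.induction_linear with
      | zero => simp only [comp_zero]
      | add h h' hh hh' => simp only [comp_add, hh, hh']
      | single r c => simp only [single_comp_single, Quiver.Path.comp_assoc, mul_assoc]

theorem comp_single_nil {x y : V} (f : PathHom k x y) :
    comp f (Finsupp.single Quiver.Path.nil 1) = f := by
  induction f using Finsupp.induction_linear with
  | zero => exact zero_comp _
  | add f f' hf hf' => rw [add_comp, hf, hf']
  | single p a => rw [single_comp_single, mul_one, Quiver.Path.comp_nil]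

theorem single_nil_comp {x y : V} (f : PathHom k x y) :
    comp (Finsupp.single Quiver.Path.nil 1) f = f := by
  induction f using Finsupp.induction_linear with
  | zero => exact comp_zero _
  | add f f' hf hf' => rw [comp_add, hf, hf']
  | single p a => rw [single_comp_single, one_mul, Quiver.Path.nil_comp]

theorem exists_of_comp_apply_ne_zero {x y z : V} {f : PathHom k x y} {g : PathHom k y z}
    {r : Quiver.Path x z} (h : comp f g r ≠ 0) :
    ∃ p q, f p ≠ 0 ∧ g q ≠ 0 ∧ r = p.comp q := by
  classical
  by_contra! hc
  apply h
  rw [comp, Finsupp.sum, Finsupp.finsetSum_apply]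
  refine Finset.sum_eq_zero fun p hp => ?_
  rw [Finsupp.sum, Finsupp.finsetSum_apply]
  refine Finset.sum_eq_zero fun q hq => ?_
  rw [Finsupp.single_apply, if_neg]
  exact fun h => hc p q (Finsupp.mem_support_iff.1 hp) (Finsupp.mem_support_iff.1 hq) h.symm

/-! ### Functors given on arrows -/

variable (F G : ∀ a : (Σ x y : V, x ⟶ y), PathHom k a.1 a.2.1)

theorem functorOfArrows_single {x y : V} (p : Quiver.Path x y) (c : k) :
    functorOfArrows F x y (Finsupp.single p c) = c • onPath F p := by
  simp [functorOfArrows]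

theorem onPath_nil (x : V) :
    onPath F (Quiver.Path.nil : Quiver.Path x x) = Finsupp.single Quiver.Path.nil 1 := rfl

theorem onPath_cons {x y z : V} (p : Quiver.Path x y) (β : y ⟶ z) :
    onPath F (p.cons β) = comp (onPath F p) (F ⟨y, z, β⟩) := rfl

theorem onPath_toPath {x y : V} (β : x ⟶ y) : onPath F β.toPath = F ⟨x, y, β⟩ :=
  single_nil_comp _

theorem onPath_comp {x y z : V} (p : Quiver.Path x y) (q : Quiver.Path y z) :
    onPath F (p.comp q) = comp (onPath F p) (onPath F q) := by
  induction q with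
  | nil => rw [Quiver.Path.comp_nil, onPath_nil, comp_single_nil]
  | cons q β ih => rw [Quiver.Path.comp_cons, onPath_cons, ih, onPath_cons, comp_assoc]

theorem functorOfArrows_comp {x y z : V} (f : PathHom k x y) (g : PathHom k y z) :
    functorOfArrows F x z (comp f g) =
      comp (functorOfArrows F x y f) (functorOfArrows F y z g) := by
  induction f using Finsupp.induction_linear with
  | zero => simp only [zero_comp, map_zero]
  | add f f' hf hf' => simp only [add_comp, map_add, hf, hf']
  | single p a =>
    induction g using Finsupp.induction_linear with
    | zero => simp only [comp_zero, map_zero]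
    | add g g' hg hg' => simp only [comp_add, map_add, hg, hg']
    | single q b =>
      simp only [single_comp_single, functorOfArrows_single, onPath_comp, smul_comp, comp_smul,
        smul_smul, mul_comm a b]

theorem functorOfArrows_onPath {x y : V} (p : Quiver.Path x y) :
    functorOfArrows F x y (onPath G p) = onPath (fun a => functorOfArrows F _ _ (G a)) p := by
  induction p with
  | nil => rw [onPath_nil, functorOfArrows_single, onPath_nil, onPath_nil, one_smul]
  | cons p β ih => rw [onPath_cons, functorOfArrows_comp, ih, onPath_cons]

theorem functorOfArrows_functorOfArrows {x y : V} (f : PathHom k x y) :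
    functorOfArrows F x y (functorOfArrows G x y f) =
      functorOfArrows (fun a => functorOfArrows F _ _ (G a)) x y f := by
  induction f using Finsupp.induction_linear with
  | zero => simp only [map_zero]
  | add f f' hf hf' => simp only [map_add, hf, hf']
  | single p a => rw [functorOfArrows_single, map_smul, functorOfArrows_onPath,
      functorOfArrows_single]

theorem onPath_id {x y : V} (p : Quiver.Path x y) :
    onPath (fun c => Finsupp.single c.2.2.toPath (1 : k)) p = Finsupp.single p 1 := by
  induction p with
  | nil => rfl
  | cons p β ih =>
    rw [onPath_cons, ih, single_comp_single, mul_one, Quiver.Path.comp_toPath_eq_cons]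

theorem functorOfArrows_id {x y : V} (f : PathHom k x y) :
    functorOfArrows (fun c => Finsupp.single c.2.2.toPath (1 : k)) x y f = f := by
  induction f using Finsupp.induction_linear with
  | zero => simp only [map_zero]
  | add f f' hf hf' => simp only [map_add, hf, hf']
  | single p a => rw [functorOfArrows_single, onPath_id, Finsupp.smul_single, smul_eq_mul, mul_one]

/-- If a relation between parallel paths is compatible with composition and relates every arrow to
the paths that appear in its image, then it relates every path to the paths that appear in its
image. -/
theorem rel_of_onPath_apply_ne_zero {R : ∀ x y : V, Quiver.Path x y → Quiver.Path x y → Prop}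
    (hnil : ∀ x, R x x Quiver.Path.nil Quiver.Path.nil)
    (hcons : ∀ {x y z : V} (p q : Quiver.Path x y) (β : y ⟶ z) (r : Quiver.Path y z),
      R x y p q → R y z β.toPath r → R x z (p.cons β) (q.comp r))
    (hF : ∀ {x y : V} (β : x ⟶ y) (r : Quiver.Path x y), F ⟨x, y, β⟩ r ≠ 0 → R x y β.toPath r)
    {x y : V} (p q : Quiver.Path x y) (h : onPath F p q ≠ 0) : R x y p q := by
  induction p with
  | nil =>
    rw [onPath_nil] at h
    obtain rfl : q = Quiver.Path.nil := by
      by_contra hne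
      exact h (Finsupp.single_eq_of_ne hne)
    exact hnil _
  | cons p β ih =>
    obtain ⟨q', r, hq', hr, rfl⟩ := exists_of_comp_apply_ne_zero h
    exact hcons p q' β r (ih q' hq') (hF β r hr)

end PathHom

/-! ## Homotopy relations and homogeneous ideals -/

namespace QuiverWalk

variable {V : Type u} [Quiver.{v} V]

theorem ofPath_comp {x y z : V} (p : Quiver.Path x y) (q : Quiver.Path y z) :
    ofPath (p.comp q) = (ofPath p).comp (ofPath q) := by
  induction q with
  | nil => rfl
  | cons q β ih =>
    rw [Quiver.Path.comp_cons]
    change (ofPath (p.comp q)).cons _ = _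
    rw [ih]
    rfl

end QuiverWalk

namespace HomotopyRel

variable {k : Type w} [Field k] {V : Type u} [Quiver.{v} V] {I : PathIdeal k V}

theorem exists_inverse_arrow {x y : V} (a : Quiver.Hom (V := Quiver.Symmetrify V) x y) :
    ∃ b : Quiver.Hom (V := Quiver.Symmetrify V) y x,
      HomotopyRel I x x ((Quiver.Path.nil.cons a).cons b) Quiver.Path.nil ∧
      HomotopyRel I y y ((Quiver.Path.nil.cons b).cons a) Quiver.Path.nil := by
  rcases a with α | α
  · exact ⟨Sum.inr α, arrow_inv α, inv_arrow α⟩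
  · exact ⟨Sum.inl α, inv_arrow α, arrow_inv α⟩

theorem of_cons {x y z : V} {p q : QuiverWalk x y}
    {a : Quiver.Hom (V := Quiver.Symmetrify V) y z}
    (h : HomotopyRel I x z (p.cons a) (q.cons a)) : HomotopyRel I x y p q := by
  obtain ⟨b, hb, -⟩ := exists_inverse_arrow (I := I) a
  have aux : ∀ r : QuiverWalk x y, HomotopyRel I x y ((r.cons a).cons b) r := fun r =>
    comp (refl r) hb
  exact (aux p).symm.trans ((comp h (refl (Quiver.Path.nil.cons b))).trans (aux q))

theorem of_comp_right {x y z : V} {p q : QuiverWalk x y} (r : QuiverWalk y z)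
    (h : HomotopyRel I x z (p.comp r) (q.comp r)) : HomotopyRel I x y p q := by
  induction r with
  | nil => exact h
  | cons r a ih => exact ih (of_cons h)

theorem of_eq {x y : V} {p q : QuiverWalk x y} (h : p = q) : HomotopyRel I x y p q :=
  h ▸ refl p

/-- Walks modulo homotopy form a groupoid, so common factors cancel. -/
theorem of_comp_left {x y z : V} (r : QuiverWalk x y) {p q : QuiverWalk y z}
    (h : HomotopyRel I x z (r.comp p) (r.comp q)) : HomotopyRel I y z p q := by
  induction r with
  | nil =>
    exact (of_eq (Quiver.Path.nil_comp p).symm).trans (h.trans (of_eq (Quiver.Path.nil_comp q)))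
  | @cons b c r a ih =>
    obtain ⟨a', -, ha'⟩ := exists_inverse_arrow (I := I) a
    let A : QuiverWalk (V := V) b c := Quiver.Path.cons Quiver.Path.nil a
    let A' : QuiverWalk (V := V) c b := Quiver.Path.cons Quiver.Path.nil a'
    have split : ∀ s : QuiverWalk (V := V) c z,
        HomotopyRel I x z
          (Quiver.Path.comp (V := Quiver.Symmetrify V) (Quiver.Path.cons r a) s)
          (Quiver.Path.comp (V := Quiver.Symmetrify V) r (A.comp s)) := fun s =>
      of_eq (Quiver.Path.comp_assoc (V := Quiver.Symmetrify V) r A s)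
    have h1 := comp (refl A') (ih ((split p).symm.trans (h.trans (split q))))
    have aux : ∀ s : QuiverWalk (V := V) c z,
        HomotopyRel I c z (A'.comp (A.comp s)) s := fun s =>
      (of_eq (Quiver.Path.comp_assoc A' A s).symm).trans
        ((comp ha' (refl s)).trans (of_eq (Quiver.Path.nil_comp s)))
    exact (aux p).symm.trans (h1.trans (aux q))

end HomotopyRel

namespace PathIdeal

variable {k : Type w} [Field k] {V : Type u} [Quiver.{v} V]

theorem ext_hom {I J : PathIdeal k V} (h : ∀ x y, I.hom x y = J.hom x y) : I = J := by
  cases I; cases J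
  congr
  funext x y
  exact h x y

/-- The homotopy relation, restricted to the oriented paths. -/
def pathRel (I : PathIdeal k V) (x y : V) (p q : Quiver.Path x y) : Prop :=
  HomotopyRel I x y (QuiverWalk.ofPath p) (QuiverWalk.ofPath q)

theorem pathRel_equivalence (I : PathIdeal k V) (x y : V) : Equivalence (I.pathRel x y) :=
  ⟨fun _ => .refl _, .symm, .trans⟩

theorem pathRel_comp {I : PathIdeal k V} {x y z : V} {p p' : Quiver.Path x y}
    {q q' : Quiver.Path y z} (hp : I.pathRel x y p p') (hq : I.pathRel y z q q') :
    I.pathRel x z (p.comp q) (p'.comp q') := by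
  unfold pathRel
  rw [QuiverWalk.ofPath_comp, QuiverWalk.ofPath_comp]
  exact .comp hp hq

/-- Cancellation makes sense of homotopy for a single substitution: if replacing `q` by `q'` inside
a longer path preserves its class, then `q` and `q'` are already homotopic. -/
theorem pathRel_of_comp_comp {I : PathIdeal k V} {x y z t : V} (p : Quiver.Path x y)
    {q q' : Quiver.Path y z} (r : Quiver.Path z t)
    (h : I.pathRel x t ((p.comp q).comp r) ((p.comp q').comp r)) : I.pathRel y z q q' := by
  unfold pathRel at h
  rw [QuiverWalk.ofPath_comp, QuiverWalk.ofPath_comp, QuiverWalk.ofPath_comp,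
    QuiverWalk.ofPath_comp] at h
  exact HomotopyRel.of_comp_left _ (HomotopyRel.of_comp_right _ h)

/-- A property that splits along the relation `∼_I` cuts every element of `I` into elements
of `I`. -/
theorem coordPart_mem (I : PathIdeal k V) {x y : V} (C : Quiver.Path x y → Prop)
    (hC : ∀ p q, I.pathRel x y p q → C p → C q) :
    ∀ r ∈ I.hom x y, coordPart C r ∈ I.hom x y := by
  classical
  suffices H : ∀ n, ∀ r ∈ I.hom x y, r.support.card ≤ n → coordPart C r ∈ I.hom x y from
    fun r hr => H _ r hr le_rfl
  intro n
  induction n with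
  | zero =>
    intro r _ hn
    have : r = 0 := Finsupp.card_support_eq_zero.1 (Nat.le_zero.1 hn)
    rw [this, map_zero]
    exact zero_mem _
  | succ n ih =>
    intro r hr hn
    by_cases h0 : r = 0
    · rw [h0, map_zero]
      exact zero_mem _
    by_cases hmin : I.IsMinimalRelation r
    · by_cases hex : ∃ p, r p ≠ 0 ∧ C p
      · obtain ⟨p, hp, hCp⟩ := hex
        rw [coordPart_eq_self fun q hq => hC p q (HomotopyRel.minimal r hmin p q
          (Finsupp.mem_support_iff.2 hp) (Finsupp.mem_support_iff.2 hq)) hCp]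
        exact hr
      · push Not at hex
        rw [coordPart_eq_zero hex]
        exact zero_mem _
    -- A non-minimal element splits along `E` into two elements of `I` with smaller supports.
    · unfold IsMinimalRelation at hmin
      push Not at hmin
      obtain ⟨E, hE, hEr, hEI⟩ := hmin hr h0
      set r' := ∑ p ∈ E, Finsupp.single p (r p) with hr'
      have happ : ∀ q, r' q = if q ∈ E then r q else 0 := by
        intro q
        rw [hr', Finsupp.finsetSum_apply]
        simp [Finsupp.single_apply]
      have h1 : r'.support ⊆ E := by
        intro q hq
        rw [Finsupp.mem_support_iff, happ] at hq
        by_contra hc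
        exact hq (if_neg hc)
      have h2 : (r - r').support ⊆ r.support \ E := by
        intro q hq
        rw [Finsupp.mem_support_iff, Finsupp.sub_apply, happ] at hq
        rw [Finset.mem_sdiff, Finsupp.mem_support_iff]
        by_cases hqE : q ∈ E
        · simp [hqE] at hq
        · simp only [hqE, if_false, sub_zero] at hq
          exact ⟨hq, hqE⟩
      have c1 : E.card < r.support.card := Finset.card_lt_card hEr
      have c2 : (r.support \ E).card < r.support.card := by
        rw [Finset.card_sdiff_of_subset hEr.1]
        have := hE.card_pos
        omega
      have m1 := ih r' hEI (by have := Finset.card_le_card h1; omega)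
      have m2 := ih (r - r') (sub_mem hr hEI) (by have := Finset.card_le_card h2; omega)
      have := add_mem m2 m1
      rwa [← map_add, sub_add_cancel] at this

theorem isHomogeneousFor_pathRel (I : PathIdeal k V) (x y : V) :
    IsHomogeneousFor (I.pathRel x y) (I.hom x y) := fun r hr _ =>
  I.coordPart_mem _ (fun _ _ hpq hp => HomotopyRel.trans (HomotopyRel.symm hpq) hp) r hr

/-- If `I` is homogeneous for `∼_J`, then `∼_I` is finer than `∼_J`. -/
theorem homotopyRel_of_isHomogeneousFor {I J : PathIdeal k V}
    (h : ∀ x y, IsHomogeneousFor (J.pathRel x y) (I.hom x y)) {x y : V} {p q : QuiverWalk x y}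
    (hpq : HomotopyRel I x y p q) : HomotopyRel J x y p q := by
  induction hpq with
  | refl p => exact .refl p
  | symm _ ih => exact .symm ih
  | trans _ _ ih ih' => exact .trans ih ih'
  | comp _ _ ih ih' => exact .comp ih ih'
  | arrow_inv α => exact .arrow_inv α
  | inv_arrow α => exact .inv_arrow α
  | @minimal x y r hr p q hp hq =>
    classical
    by_contra hc
    have hmem := h x y r hr.1 q
    have hsupp : ∀ p', p' ∈ r.support.filter (fun p' => J.pathRel x y p' q) ↔
        p' ∈ r.support ∧ J.pathRel x y p' q := fun p' => Finset.mem_filter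
    -- If `p` and `q` were not related, the part of `r` in the class of `q` would be a proper
    -- nonempty part lying in `I`, against minimality.
    refine hr.2.2 (r.support.filter fun p' => J.pathRel x y p' q)
      ⟨q, (hsupp q).2 ⟨hq, .refl _⟩⟩ ⟨Finset.filter_subset _ _, fun hsub => ?_⟩ ?_
    · exact hc ((hsupp p).1 (hsub hp)).2
    · convert hmem using 1
      ext p'
      rw [Finsupp.finsetSum_apply, coordPart_apply]
      simp only [Finsupp.single_apply, Finset.sum_ite_eq', hsupp, Finsupp.mem_support_iff]
      by_cases h1 : J.pathRel x y p' q <;> by_cases h2 : r p' = 0 <;> simp [h1, h2]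

/-- The inverse image of an ideal under the functor given by `F` on the arrows. -/
def comap (F : ∀ a : (Σ x y : V, x ⟶ y), PathHom k a.1 a.2.1) (I : PathIdeal k V) :
    PathIdeal k V where
  hom x y := (I.hom x y).comap (PathHom.functorOfArrows F x y)
  comp_mem_left f g hf := by
    rw [Submodule.mem_comap, PathHom.functorOfArrows_comp]
    exact I.comp_mem_left _ _ hf
  comp_mem_right f g hg := by
    rw [Submodule.mem_comap, PathHom.functorOfArrows_comp]
    exact I.comp_mem_right _ _ hg

theorem mem_comap {F : ∀ a : (Σ x y : V, x ⟶ y), PathHom k a.1 a.2.1} {I : PathIdeal k V}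
    {x y : V} {f : PathHom k x y} :
    f ∈ (I.comap F).hom x y ↔ PathHom.functorOfArrows F x y f ∈ I.hom x y := Iff.rfl

theorem comap_comap (F G : ∀ a : (Σ x y : V, x ⟶ y), PathHom k a.1 a.2.1) (I : PathIdeal k V) :
    (I.comap F).comap G = I.comap fun a => PathHom.functorOfArrows F _ _ (G a) :=
  ext_hom fun x y => by
    ext f
    rw [mem_comap, mem_comap, mem_comap, PathHom.functorOfArrows_functorOfArrows]

theorem comap_id (I : PathIdeal k V) :
    I.comap (fun c => Finsupp.single c.2.2.toPath (1 : k)) = I :=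
  ext_hom fun x y => by
    ext f
    rw [mem_comap, PathHom.functorOfArrows_id]

/-- A functor that preserves the classes of `∼_I` does not enlarge the homotopy relation. -/
theorem homotopyRel_of_comap {F : ∀ a : (Σ x y : V, x ⟶ y), PathHom k a.1 a.2.1}
    {I : PathIdeal k V}
    (hF : ∀ {x y : V} (β : x ⟶ y) (r : Quiver.Path x y), F ⟨x, y, β⟩ r ≠ 0 →
      I.pathRel x y β.toPath r)
    {x y : V} {p q : QuiverWalk x y} (h : HomotopyRel (I.comap F) x y p q) :
    HomotopyRel I x y p q := by
  refine homotopyRel_of_isHomogeneousFor (fun x y r hr p => ?_) h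
  rw [mem_comap]
  have hrel : ∀ p q : Quiver.Path x y, PathHom.onPath F p q ≠ 0 → I.pathRel x y p q := fun p q =>
    PathHom.rel_of_onPath_apply_ne_zero F (R := fun x y => I.pathRel x y)
      (fun _ => .refl _) (fun p q β r hp hβ => by
        rw [← Quiver.Path.comp_toPath_eq_cons]
        exact pathRel_comp hp hβ) hF p q
  -- The functor sends a path to a combination of paths of the same class, so it commutes with the
  -- projections onto classes.
  have comm : ∀ f : PathHom k x y,
      PathHom.functorOfArrows F x y (coordPart (fun q => I.pathRel x y q p) f) =
        coordPart (fun q => I.pathRel x y q p) (PathHom.functorOfArrows F x y f) := by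
    intro f
    have heq := I.pathRel_equivalence x y
    induction f using Finsupp.induction_linear with
    | zero => simp only [map_zero]
    | add f f' hf hf' => simp only [map_add, hf, hf']
    | single p' a =>
      have hsupp : ∀ q, (Finsupp.single p' a : PathHom k x y) q ≠ 0 → q = p' := fun q hq => by
        by_contra hne
        exact hq (Finsupp.single_eq_of_ne hne)
      by_cases hp' : I.pathRel x y p' p
      · rw [coordPart_eq_self fun q hq => by rw [hsupp q hq]; exact hp',
          PathHom.functorOfArrows_single, map_smul,
          coordPart_eq_self fun q hq => (heq.trans (heq.symm (hrel p' q hq)) hp' : I.pathRel x y q p)]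
      · rw [coordPart_eq_zero fun q hq => by rw [hsupp q hq]; exact hp', map_zero,
          PathHom.functorOfArrows_single, map_smul,
          coordPart_eq_zero fun q hq (hqp : I.pathRel x y q p) => hp' (heq.trans (hrel p' q hq) hqp),
          smul_zero]
  rw [comm]
  exact I.isHomogeneousFor_pathRel x y _ hr p

/-- If there are finitely many paths, there are finitely many homotopy relations. -/
theorem finite_range_homotopyRel [Finite V] (hfin : ∀ x y : V, Finite (Quiver.Path x y)) :
    (Set.range fun I : PathIdeal k V => HomotopyRel I).Finite := by
  -- `m I` is the trace of `∼_I` on oriented paths. It ranges over subsets of a finite set, and it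
  -- determines `∼_I` because minimal relations only involve oriented paths.
  let m : PathIdeal k V → Set (Σ x y : V, Quiver.Path x y × Quiver.Path x y) := fun I =>
    {a | I.pathRel a.1 a.2.1 a.2.2.1 a.2.2.2}
  have hm : ∀ I J : PathIdeal k V, m I ⊆ m J → ∀ {x y : V} {p q : QuiverWalk x y},
      HomotopyRel I x y p q → HomotopyRel J x y p q := by
    intro I J hIJ x y p q hpq
    refine homotopyRel_of_isHomogeneousFor (fun x y r hr p => ?_) hpq
    refine I.coordPart_mem _ (fun p' q' hpq' hp' => ?_) r hr
    have : (⟨x, y, q', p'⟩ : Σ x y : V, Quiver.Path x y × Quiver.Path x y) ∈ m I :=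
      HomotopyRel.symm hpq'
    exact HomotopyRel.trans (hIJ this) hp'
  have hfac : ∀ I J : PathIdeal k V, m I = m J → HomotopyRel I = HomotopyRel J := by
    intro I J h
    funext x y p q
    exact propext ⟨hm I J h.le, hm J I h.ge⟩
  obtain ⟨g, hg⟩ : ∃ g : Set (Σ x y : V, Quiver.Path x y × Quiver.Path x y) → WalkRel V,
      ∀ I, g (m I) = HomotopyRel I :=
    (Function.factorsThrough_iff _).1 (fun I J h => hfac I J h) |>.imp fun g hg I =>
      (congrFun hg I).symm
  refine (Set.finite_range g).subset ?_
  rintro _ ⟨I, rfl⟩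
  exact ⟨m I, hg I⟩

end PathIdeal

/-! ## Quivers without double bypass -/

namespace NoDoubleBypass

variable {V : Type u} [Quiver.{v} V]

/-- The last arrow `β` of a nontrivial cycle, followed by the cycle, is a bypass of `β` in which `β`
itself appears. -/
theorem eq_nil (hdb : NoDoubleBypass V) {x : V} (p : Quiver.Path x x) : p = Quiver.Path.nil := by
  rcases p with _ | ⟨p, β⟩
  · rfl
  · exfalso
    have hb : IsBypass β (β.toPath.comp (p.cons β)) := fun h => by
      have := congrArg Quiver.Path.length h
      simp at this
    exact hdb β _ hb β _ hb ⟨Quiver.Path.nil, p.cons β, rfl⟩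

/-- Two distinct parallel arrows would be bypasses of each other. -/
theorem arrow_eq (hdb : NoDoubleBypass V) {x y : V} (α β : x ⟶ y) : α = β := by
  by_contra hne
  have h1 : IsBypass α β.toPath := fun h => hne (by cases h; rfl)
  have h2 : IsBypass β α.toPath := fun h => hne (by cases h; rfl)
  exact hdb α _ h1 β _ h2 ⟨Quiver.Path.nil, Quiver.Path.nil, rfl⟩

theorem two_le_length (hdb : NoDoubleBypass V) {x y : V} {α : x ⟶ y} {p : Quiver.Path x y}
    (h : IsBypass α p) : 2 ≤ p.length := by
  rcases p with _ | ⟨p, β⟩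
  · exact absurd (hdb.eq_nil α.toPath) (Quiver.Path.cons_ne_nil _ _)
  rcases p with _ | ⟨p, γ⟩
  · exact absurd (congrArg Quiver.Hom.toPath (hdb.arrow_eq β α)) h
  · simp only [Quiver.Path.length_cons]
    omega

/-- In the absence of cycles, being joined by a nontrivial path is a strict order on a finite set.
Induction along it on the end vertex removes the last arrow. -/
theorem finite_path [Finite V] (hdb : NoDoubleBypass V) (hfin : ∀ x y : V, Finite (x ⟶ y))
    (x y : V) : Finite (Quiver.Path x y) := by
  let r : V → V → Prop := fun y z => ∃ p : Quiver.Path y z, p.length ≠ 0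
  have : IsTrans V r := ⟨fun a b c ⟨p, hp⟩ ⟨q, _⟩ => ⟨p.comp q, by
    rw [Quiver.Path.length_comp]; omega⟩⟩
  have : Std.Irrefl r := ⟨fun a ⟨p, hp⟩ => hp (by rw [hdb.eq_nil p]; rfl)⟩
  have wf : WellFounded r := Finite.wellFounded_of_trans_of_irrefl r
  induction y using wf.induction with
  | _ y ih =>
    have : ∀ z : {z : V // Nonempty (z ⟶ y)}, Finite (Quiver.Path x z.1 × (z.1 ⟶ y)) := by
      rintro ⟨z, ⟨β⟩⟩
      have := ih z ⟨β.toPath, by simp⟩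
      have := hfin z y
      infer_instance
    by_cases hxy : x = y
    · subst hxy
      have : Subsingleton (Quiver.Path x x) := ⟨fun p q => by rw [hdb.eq_nil p, hdb.eq_nil q]⟩
      infer_instance
    · refine Finite.of_surjective
        (fun a : Σ z : {z : V // Nonempty (z ⟶ y)}, Quiver.Path x z.1 × (z.1 ⟶ y) =>
          a.2.1.cons a.2.2) fun p => ?_
      rcases p with _ | ⟨p, β⟩
      · exact absurd rfl hxy
      · exact ⟨⟨⟨_, ⟨β⟩⟩, p, β⟩, rfl⟩

end NoDoubleBypass

/-- An arrow is rigid if it is the only path between its endpoints. -/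
def IsRigidArrow {V : Type u} [Quiver.{v} V] {x y : V} (β : x ⟶ y) : Prop :=
  ∀ p : Quiver.Path x y, p = β.toPath

/-- A path is rigid if all its arrows are. -/
def IsRigidPath {V : Type u} [Quiver.{v} V] {x y : V} (p : Quiver.Path x y) : Prop :=
  ∀ ⦃z t : V⦄ (β : z ⟶ t), ArrowAppears β p → IsRigidArrow β

section Rigid

variable {V : Type u} [Quiver.{v} V]

/-- This is the form in which the hypothesis acts on functors: a bypass offers no arrow to perturb.
-/
theorem NoDoubleBypass.isRigidPath (hdb : NoDoubleBypass V) {x y : V} {α : x ⟶ y}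
    {p : Quiver.Path x y} (h : IsBypass α p) : IsRigidPath p := by
  intro z t β hβ q
  by_contra hq
  exact hdb α p h β q hq hβ

theorem IsRigidPath.of_cons {x y z : V} {p : Quiver.Path x y} {β : y ⟶ z}
    (h : IsRigidPath (p.cons β)) : IsRigidPath p ∧ IsRigidArrow β := by
  refine ⟨fun a b γ ⟨q, r, hqr⟩ => h γ ⟨q, r.cons β, ?_⟩, h β ⟨p, Quiver.Path.nil, rfl⟩⟩
  rw [hqr]
  rfl

open Classical in
/-- The number of arrows in a path that are not rigid. -/
def bypassWeight {x : V} : ∀ {y : V}, Quiver.Path x y → ℕ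
  | _, Quiver.Path.nil => 0
  | _, Quiver.Path.cons p β => bypassWeight p + if IsRigidArrow β then 0 else 1

theorem bypassWeight_comp {x y z : V} (p : Quiver.Path x y) (q : Quiver.Path y z) :
    bypassWeight (p.comp q) = bypassWeight p + bypassWeight q := by
  induction q with
  | nil => rfl
  | cons q β ih =>
    rw [Quiver.Path.comp_cons, bypassWeight, ih, bypassWeight, add_assoc]

theorem IsRigidPath.bypassWeight_eq_zero {x y : V} {p : Quiver.Path x y} (h : IsRigidPath p) :
    bypassWeight p = 0 := by
  induction p with
  | nil => rfl
  | cons p β ih => rw [bypassWeight, ih h.of_cons.1, if_pos h.of_cons.2]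

end Rigid

/-! ## Unipotent functors and their logarithms -/

namespace PathHom

variable {k : Type w} [Field k] {V : Type u} [Quiver.{v} V]

/-- The image of a rigid arrow has nowhere to go but the line spanned by that arrow. -/
theorem exists_onPath_eq_of_isRigidPath (F : ∀ a : (Σ x y : V, x ⟶ y), PathHom k a.1 a.2.1)
    {x y : V} {p : Quiver.Path x y} (h : IsRigidPath p) :
    ∃ c : k, onPath F p = Finsupp.single p c ∧
      ((∀ {x y : V} (β : x ⟶ y), F ⟨x, y, β⟩ β.toPath = 1) → c = 1) := by
  induction p with
  | nil => exact ⟨1, rfl, fun _ => rfl⟩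
  | @cons y z p β ih =>
    obtain ⟨c, hc, hc1⟩ := ih h.of_cons.1
    have hβ : F ⟨y, z, β⟩ = Finsupp.single β.toPath (F ⟨y, z, β⟩ β.toPath) := by
      ext q
      rw [h.of_cons.2 q, Finsupp.single_eq_same]
    refine ⟨c * F ⟨y, z, β⟩ β.toPath, ?_, fun hF => by rw [hc1 hF, hF, mul_one]⟩
    rw [onPath_cons, hc, hβ, single_comp_single, Finsupp.single_eq_same,
      Quiver.Path.comp_toPath_eq_cons]

theorem functorOfArrows_eq_self {F : ∀ a : (Σ x y : V, x ⟶ y), PathHom k a.1 a.2.1}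
    {x y : V} {f : PathHom k x y} (h : ∀ p, f p ≠ 0 → onPath F p = Finsupp.single p 1) :
    functorOfArrows F x y f = f := by
  rw [functorOfArrows, Finsupp.linearCombination_apply]
  conv_rhs => rw [← Finsupp.sum_single f]
  refine Finsupp.sum_congr fun p hp => ?_
  rw [h p (Finsupp.mem_support_iff.1 hp), Finsupp.smul_single, smul_eq_mul, mul_one]

/-- A family of morphisms indexed by the arrows in which `β` does not appear at `β`. -/
def IsBypassFamily (t : ∀ a : (Σ x y : V, x ⟶ y), PathHom k a.1 a.2.1) : Prop :=
  ∀ {x y : V} (β : x ⟶ y), t ⟨x, y, β⟩ β.toPath = 0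

/-- The values on the arrows of the functor `β ↦ β + t β`. -/
def unip (t : ∀ a : (Σ x y : V, x ⟶ y), PathHom k a.1 a.2.1) :
    ∀ a : (Σ x y : V, x ⟶ y), PathHom k a.1 a.2.1 :=
  fun a => Finsupp.single a.2.2.toPath 1 + t a

variable {s t : ∀ a : (Σ x y : V, x ⟶ y), PathHom k a.1 a.2.1}

theorem IsBypassFamily.isBypass (ht : IsBypassFamily t) {x y : V} {β : x ⟶ y}
    {p : Quiver.Path x y} (h : t ⟨x, y, β⟩ p ≠ 0) : IsBypass β p :=
  fun hp => h (by rw [hp]; exact ht β)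

theorem IsBypassFamily.add (hs : IsBypassFamily s) (ht : IsBypassFamily t) :
    IsBypassFamily (s + t) := fun β => by
  rw [Pi.add_apply, Finsupp.add_apply, hs β, ht β, add_zero]

theorem IsBypassFamily.neg (ht : IsBypassFamily t) : IsBypassFamily (-t) := fun β => by
  rw [Pi.neg_apply, Finsupp.neg_apply, ht β, neg_zero]

theorem unip_toPath (ht : IsBypassFamily t) {x y : V} (β : x ⟶ y) :
    unip t ⟨x, y, β⟩ β.toPath = 1 := by
  rw [unip, Finsupp.add_apply, Finsupp.single_eq_same, ht β, add_zero]

theorem unip_zero : unip (0 : ∀ a : (Σ x y : V, x ⟶ y), PathHom k a.1 a.2.1) =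
    fun c => Finsupp.single c.2.2.toPath (1 : k) := by
  funext a
  rw [unip, Pi.zero_apply, add_zero]

/-- The bypasses occurring in `t` are rigid, so `unip s` fixes them and only the leading arrow is
perturbed again. The unipotent functors thus form an abelian group, with inverses given by `-t`. -/
theorem functorOfArrows_unip_unip (hdb : NoDoubleBypass V) (hs : IsBypassFamily s)
    (ht : IsBypassFamily t) (a : Σ x y : V, x ⟶ y) :
    functorOfArrows (unip s) a.1 a.2.1 (unip t a) = unip (s + t) a := by
  obtain ⟨x, y, β⟩ := a
  have h1 : functorOfArrows (unip s) x y (t ⟨x, y, β⟩) = t ⟨x, y, β⟩ := by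
    refine functorOfArrows_eq_self fun p hp => ?_
    obtain ⟨c, hc, hc1⟩ := exists_onPath_eq_of_isRigidPath (unip s)
      (hdb.isRigidPath (ht.isBypass hp))
    rw [hc, hc1 (unip_toPath hs)]
  change functorOfArrows (unip s) x y (Finsupp.single β.toPath 1 + t ⟨x, y, β⟩) = _
  rw [map_add, h1, functorOfArrows_single, one_smul, onPath_toPath]
  simp only [unip, Pi.add_apply, add_assoc]

theorem functorOfArrows_unip_neg (hdb : NoDoubleBypass V) (ht : IsBypassFamily t) {x y : V}
    (f : PathHom k x y) :
    functorOfArrows (unip t) x y (functorOfArrows (unip (-t)) x y f) = f := by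
  rw [functorOfArrows_functorOfArrows]
  simp only [functorOfArrows_unip_unip hdb ht ht.neg, add_neg_cancel, unip_zero]
  exact functorOfArrows_id f

/-- The derivation `β ↦ t β`, evaluated at a path. -/
def derivOnPath (t : ∀ a : (Σ x y : V, x ⟶ y), PathHom k a.1 a.2.1) {x : V} :
    ∀ {y : V}, Quiver.Path x y → PathHom k x y
  | _, Quiver.Path.nil => 0
  | _, Quiver.Path.cons p β => comp (derivOnPath t p) (Finsupp.single β.toPath 1) +
      comp (Finsupp.single p 1) (t ⟨_, _, β⟩)

/-- The derivation of `kQ` that sends each arrow `β` to `t β`. -/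
def deriv (t : ∀ a : (Σ x y : V, x ⟶ y), PathHom k a.1 a.2.1) (x y : V) :
    PathHom k x y →ₗ[k] PathHom k x y :=
  Finsupp.linearCombination k (derivOnPath t)

theorem deriv_single {x y : V} (p : Quiver.Path x y) (c : k) :
    deriv t x y (Finsupp.single p c) = c • derivOnPath t p := by
  simp [deriv]

theorem derivOnPath_cons {x y z : V} (p : Quiver.Path x y) (β : y ⟶ z) :
    derivOnPath t (p.cons β) = comp (derivOnPath t p) (Finsupp.single β.toPath 1) +
      comp (Finsupp.single p 1) (t ⟨_, _, β⟩) := rfl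

theorem derivOnPath_toPath {x y : V} (β : x ⟶ y) : derivOnPath t β.toPath = t ⟨x, y, β⟩ := by
  change comp 0 _ + comp _ _ = _
  rw [zero_comp, zero_add, single_nil_comp]

theorem derivOnPath_comp {x y z : V} (p : Quiver.Path x y) (q : Quiver.Path y z) :
    derivOnPath t (p.comp q) = comp (derivOnPath t p) (Finsupp.single q 1) +
      comp (Finsupp.single p 1) (derivOnPath t q) := by
  induction q with
  | nil =>
    change _ = _ + comp _ 0
    rw [Quiver.Path.comp_nil, comp_single_nil, comp_zero, add_zero]
  | cons q β ih =>
    rw [Quiver.Path.comp_cons, derivOnPath_cons, ih, derivOnPath_cons, add_comp, comp_add,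
      comp_assoc, comp_assoc, single_comp_single, mul_one, Quiver.Path.comp_toPath_eq_cons,
      ← comp_assoc (Finsupp.single p 1) (Finsupp.single q 1), single_comp_single, mul_one,
      add_assoc]

theorem deriv_comp {x y z : V} (f : PathHom k x y) (g : PathHom k y z) :
    deriv t x z (comp f g) = comp (deriv t x y f) g + comp f (deriv t y z g) := by
  induction f using Finsupp.induction_linear with
  | zero => simp only [zero_comp, map_zero, add_zero]
  | add f f' hf hf' =>
    simp only [add_comp, map_add, hf, hf']
    abel
  | single p a =>
    induction g using Finsupp.induction_linear with
    | zero => simp only [comp_zero, map_zero, add_zero]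
    | add g g' hg hg' =>
      simp only [comp_add, map_add, hg, hg']
      abel
    | single q b =>
      have e1 : (Finsupp.single p a : PathHom k x y) = a • Finsupp.single p 1 := by simp
      have e2 : (Finsupp.single q b : PathHom k y z) = b • Finsupp.single q 1 := by simp
      rw [single_comp_single, deriv_single, deriv_single, deriv_single, derivOnPath_comp, e1, e2]
      simp only [smul_comp, comp_smul, smul_smul, smul_add, mul_comm a b]

theorem deriv_neg {x y : V} (f : PathHom k x y) : deriv (-t) x y f = -deriv t x y f := by
  have H : ∀ {x y : V} (p : Quiver.Path x y), derivOnPath (-t) p = -derivOnPath t p := by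
    intro x y p
    have neg_comp : ∀ {x y z : V} (f : PathHom k x y) (g : PathHom k y z),
        comp (-f) g = -comp f g := fun f g => by
      rw [← neg_one_smul k f, smul_comp, neg_one_smul]
    have comp_neg : ∀ {x y z : V} (f : PathHom k x y) (g : PathHom k y z),
        comp f (-g) = -comp f g := fun f g => by
      rw [← neg_one_smul k g, comp_smul, neg_one_smul]
    induction p with
    | nil => exact neg_zero.symm
    | cons p β ih =>
      rw [derivOnPath_cons, ih, derivOnPath_cons, Pi.neg_apply, neg_comp, comp_neg, neg_add]
  induction f using Finsupp.induction_linear with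
  | zero => simp only [map_zero, neg_zero]
  | add f f' hf hf' => rw [map_add, map_add, hf, hf', neg_add]
  | single p a => rw [deriv_single, deriv_single, H, smul_neg]

theorem exists_of_derivOnPath_apply_ne_zero {x y : V} {p q : Quiver.Path x y}
    (h : derivOnPath t p q ≠ 0) :
    ∃ (z z' : V) (β : z ⟶ z') (a : Quiver.Path x z) (r : Quiver.Path z z') (b : Quiver.Path z' y),
      t ⟨z, z', β⟩ r ≠ 0 ∧ p = (a.comp β.toPath).comp b ∧ q = (a.comp r).comp b := by
  induction p with
  | nil => exact absurd rfl h
  | @cons y y' p β ih =>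
    rw [derivOnPath_cons, Finsupp.add_apply] at h
    by_cases h1 : comp (derivOnPath t p) (Finsupp.single β.toPath 1) q = 0
    · rw [h1, zero_add] at h
      obtain ⟨p', r, hp', hr, rfl⟩ := exists_of_comp_apply_ne_zero h
      obtain rfl : p' = p := by
        by_contra hne
        exact hp' (Finsupp.single_eq_of_ne hne)
      exact ⟨y, y', β, p', r, Quiver.Path.nil, hr, rfl, rfl⟩
    · obtain ⟨p', r, hp', hr, rfl⟩ := exists_of_comp_apply_ne_zero h1
      obtain rfl : r = β.toPath := by
        by_contra hne
        exact hr (Finsupp.single_eq_of_ne hne)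
      obtain ⟨z, z', γ, a, r, b, htr, rfl, rfl⟩ := ih hp'
      exact ⟨z, z', γ, a, r, b.cons β, htr, rfl, rfl⟩

/-- One arrow, not rigid since it has a bypass, is replaced by a rigid path: the weight drops by
one. -/
theorem bypassWeight_lt_of_derivOnPath (hdb : NoDoubleBypass V) (ht : IsBypassFamily t)
    {x y : V} {p q : Quiver.Path x y} (h : derivOnPath t p q ≠ 0) :
    bypassWeight q < bypassWeight p := by
  obtain ⟨z, z', β, a, r, b, htr, rfl, rfl⟩ := exists_of_derivOnPath_apply_ne_zero h
  have hb := ht.isBypass htr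
  have hβ : bypassWeight β.toPath = 1 := by
    change 0 + _ = 1
    rw [if_neg fun hr : IsRigidArrow β => hb (hr r)]
  simp only [bypassWeight_comp, hβ, (hdb.isRigidPath hb).bypassWeight_eq_zero]
  omega

/-- Bypasses have weight zero, so nothing is left to replace: the derivation squares to zero on
arrows. -/
theorem deriv_apply_bypass (hdb : NoDoubleBypass V) (ht : IsBypassFamily t) {x y : V}
    (β : x ⟶ y) : deriv t x y (t ⟨x, y, β⟩) = 0 := by
  rw [deriv, Finsupp.linearCombination_apply]
  refine Finset.sum_eq_zero fun p hp => ?_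
  have h0 : derivOnPath t p = 0 := by
    ext q
    by_contra hq
    have := bypassWeight_lt_of_derivOnPath hdb ht hq
    rw [(hdb.isRigidPath (ht.isBypass (Finsupp.mem_support_iff.1 hp))).bypassWeight_eq_zero] at this
    omega
  simp only [h0, smul_zero]

/-- The part of the image of a path under `unip t` in which `n` arrows have been replaced. -/
def replaceOnPath (t : ∀ a : (Σ x y : V, x ⟶ y), PathHom k a.1 a.2.1) {x : V} :
    ∀ {y : V}, Quiver.Path x y → ℕ → PathHom k x y
  | _, Quiver.Path.nil => fun n => if n = 0 then Finsupp.single Quiver.Path.nil 1 else 0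
  | _, Quiver.Path.cons p β => fun n =>
      comp (replaceOnPath t p n) (Finsupp.single β.toPath 1) +
        if n = 0 then 0 else comp (replaceOnPath t p (n - 1)) (t ⟨_, _, β⟩)

theorem replaceOnPath_nil_succ (x : V) (n : ℕ) :
    replaceOnPath t (Quiver.Path.nil : Quiver.Path x x) (n + 1) = 0 := by
  simp [replaceOnPath]

theorem replaceOnPath_cons_zero {x y z : V} (p : Quiver.Path x y) (β : y ⟶ z) :
    replaceOnPath t (p.cons β) 0 =
      comp (replaceOnPath t p 0) (Finsupp.single β.toPath 1) := by
  simp [replaceOnPath]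

theorem replaceOnPath_zero {x y : V} (p : Quiver.Path x y) :
    replaceOnPath t p 0 = Finsupp.single p 1 := by
  induction p with
  | nil => rfl
  | cons p β ih =>
    rw [replaceOnPath_cons_zero, ih, single_comp_single, mul_one,
      Quiver.Path.comp_toPath_eq_cons]

theorem replaceOnPath_cons_succ {x y z : V} (p : Quiver.Path x y) (β : y ⟶ z) (n : ℕ) :
    replaceOnPath t (p.cons β) (n + 1) =
      comp (replaceOnPath t p (n + 1)) (Finsupp.single β.toPath 1) +
        comp (replaceOnPath t p n) (t ⟨_, _, β⟩) := by
  simp [replaceOnPath]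

theorem onPath_unip_eq_sum {x y : V} (p : Quiver.Path x y) {N : ℕ} (h : p.length < N) :
    onPath (unip t) p = ∑ n ∈ Finset.range N, replaceOnPath t p n := by
  induction p generalizing N with
  | nil =>
    obtain ⟨m, rfl⟩ : ∃ m, N = m + 1 := ⟨N - 1, by simp at h; omega⟩
    rw [Finset.sum_range_succ', Finset.sum_eq_zero fun i _ => replaceOnPath_nil_succ _ i, zero_add]
    rfl
  | @cons y z p β ih =>
    obtain ⟨m, rfl⟩ : ∃ m, N = m + 1 := ⟨N - 1, by simp at h; omega⟩
    rw [Quiver.Path.length_cons] at h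
    have hcomp : ∀ (M : ℕ) (g : PathHom k y z),
        comp (∑ n ∈ Finset.range M, replaceOnPath t p n) g =
          ∑ n ∈ Finset.range M, comp (replaceOnPath t p n) g := fun M g => by
      simp only [← compBilin_apply, map_sum, LinearMap.sum_apply]
    rw [onPath_cons, unip, comp_add, ih (N := m + 1) (by omega), hcomp]
    -- The two copies of `onPath (unip t) p` are expanded to different lengths, `m + 1` and `m`: the
    -- copy where `β` itself is replaced is shifted by one replacement.
    rw [← ih (N := m + 1) (by omega), ih (N := m) (by omega), hcomp]
    rw [Finset.sum_range_succ' (fun n => replaceOnPath t (p.cons β) n)]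
    simp only [replaceOnPath_cons_succ, Finset.sum_add_distrib]
    rw [Finset.sum_range_succ']
    rw [replaceOnPath_cons_zero]
    abel

/-- A choice of `n + 1` replaced arrows is reached from `n + 1` choices of `n` of them, and an arrow
already replaced contributes nothing. So the part with `n` replacements is the `n`-th term of an
exponential series. -/
theorem deriv_replaceOnPath (hdb : NoDoubleBypass V) (ht : IsBypassFamily t) {x y : V}
    (p : Quiver.Path x y) (n : ℕ) :
    deriv t x y (replaceOnPath t p n) = ((n + 1 : ℕ) : k) • replaceOnPath t p (n + 1) := by
  induction p generalizing n with
  | nil =>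
    rw [replaceOnPath_nil_succ, smul_zero]
    rcases n with _ | n
    · rw [replaceOnPath_zero, deriv_single]
      exact smul_zero _
    · rw [replaceOnPath_nil_succ, map_zero]
  | @cons y z p β ih =>
    have hβ : deriv t y z (Finsupp.single β.toPath 1) = t ⟨y, z, β⟩ := by
      rw [deriv_single, one_smul, derivOnPath_toPath]
    rw [replaceOnPath_cons_succ]
    rcases n with _ | n
    · rw [replaceOnPath_cons_zero, deriv_comp, ih, hβ, smul_comp]
      simp
    · rw [replaceOnPath_cons_succ, map_add, deriv_comp, deriv_comp, ih, ih, hβ,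
        deriv_apply_bypass hdb ht, comp_zero, add_zero, smul_comp, smul_comp]
      push_cast
      module

/-- The functor `β ↦ β + t β` is the exponential of the derivation `β ↦ t β`; here only
the terms of order at least two are located. -/
theorem functorOfArrows_unip_sub_mem [CharZero k] (hdb : NoDoubleBypass V) (ht : IsBypassFamily t)
    {x y : V} [Finite (Quiver.Path x y)] (f : PathHom k x y) (L : Submodule k (PathHom k x y))
    (hL : ∀ g ∈ L, deriv t x y g ∈ L) (hf : deriv t x y (deriv t x y f) ∈ L) :
    functorOfArrows (unip t) x y f - f - deriv t x y f ∈ L := by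
  obtain ⟨N, hN⟩ : ∃ N, ∀ p : Quiver.Path x y, p.length < N + 2 := by
    obtain ⟨N, hN⟩ := (Set.finite_range fun p : Quiver.Path x y => p.length).bddAbove
    exact ⟨N, fun p => by have := hN ⟨p, rfl⟩; simp only at this; omega⟩
  let E : ℕ → PathHom k x y →ₗ[k] PathHom k x y := fun n =>
    Finsupp.linearCombination k fun p => replaceOnPath t p n
  have hE : ∀ n p, E n (Finsupp.single p 1) = replaceOnPath t p n := fun n p => by simp [E]
  have hE0 : E 0 = LinearMap.id := by
    ext1 p
    ext1
    simp [hE, replaceOnPath_zero]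
  have hEs : ∀ n, deriv t x y ∘ₗ E n = ((n + 1 : ℕ) : k) • E (n + 1) := by
    intro n
    ext1 p
    ext1
    simp only [LinearMap.comp_apply, Finsupp.lsingle_apply, LinearMap.smul_apply, hE]
    exact deriv_replaceOnPath hdb ht p n
  -- Characteristic zero is needed to divide by `n + 1`: each term is then a multiple of the
  -- derivation applied to the previous one, and all terms from order two on stay in `L`.
  have hEs' : ∀ n f, E (n + 1) f = ((n + 1 : ℕ) : k)⁻¹ • deriv t x y (E n f) := by
    intro n f
    have h1 : deriv t x y (E n f) = ((n + 1 : ℕ) : k) • E (n + 1) f := LinearMap.congr_fun (hEs n) f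
    have h0 : ((n + 1 : ℕ) : k) ≠ 0 := Nat.cast_ne_zero.2 (Nat.succ_ne_zero n)
    rw [h1, smul_smul, inv_mul_cancel₀ h0, one_smul]
  have hE1 : E 1 f = deriv t x y f := by
    rw [hEs' 0 f, hE0]
    simp
  have hmem : ∀ n, E (n + 2) f ∈ L := by
    intro n
    induction n with
    | zero =>
      rw [hEs' 1 f, hE1]
      exact L.smul_mem _ hf
    | succ n ih =>
      rw [hEs' (n + 2) f]
      exact L.smul_mem _ (hL _ ih)
  have hsum : functorOfArrows (unip t) x y f = ∑ n ∈ Finset.range (N + 2), E n f := by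
    have : functorOfArrows (unip t) x y = ∑ n ∈ Finset.range (N + 2), E n := by
      ext1 p
      ext1
      simp only [LinearMap.comp_apply, Finsupp.lsingle_apply, LinearMap.sum_apply, hE,
        functorOfArrows_single, one_smul]
      exact onPath_unip_eq_sum p (hN p)
    rw [this, LinearMap.sum_apply]
  rw [hsum, Finset.sum_range_succ', Finset.sum_range_succ', hE0, zero_add, hE1]
  simp only [LinearMap.id_apply, add_sub_cancel_right]
  exact sum_mem fun n _ => hmem n

end PathHom

/-! ## Ideals under unipotent functors and dilatations -/

namespace PathIdeal

open PathHom

variable {k : Type w} [Field k] {V : Type u} [Quiver.{v} V]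
  {t : ∀ a : (Σ x y : V, x ⟶ y), PathHom k a.1 a.2.1}

theorem comap_unip_add (hdb : NoDoubleBypass V)
    {s t : ∀ a : (Σ x y : V, x ⟶ y), PathHom k a.1 a.2.1} (hs : IsBypassFamily s)
    (ht : IsBypassFamily t) (I : PathIdeal k V) :
    I.comap (unip (s + t)) = (I.comap (unip s)).comap (unip t) := by
  rw [comap_comap]
  congr 1
  funext a
  exact (functorOfArrows_unip_unip hdb hs ht a).symm

theorem comap_unip_zero (I : PathIdeal k V) : I.comap (unip 0) = I := by
  rw [unip_zero, comap_id]

theorem comap_unip_neg_comap (hdb : NoDoubleBypass V) (ht : IsBypassFamily t)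
    (I : PathIdeal k V) : (I.comap (unip t)).comap (unip (-t)) = I := by
  rw [← comap_unip_add hdb ht ht.neg, add_neg_cancel, comap_unip_zero]

/-- If the bypasses involved in `t` are homotopic neither for `I` nor for its inverse image under
`β ↦ β + t β`, then both ideals coincide. -/
theorem comap_unip_eq_self [CharZero k] (hdb : NoDoubleBypass V)
    (hfin : ∀ x y : V, Finite (Quiver.Path x y)) (ht : IsBypassFamily t) (I : PathIdeal k V)
    (h : ∀ {x y : V} (β : x ⟶ y) (p : Quiver.Path x y), t ⟨x, y, β⟩ p ≠ 0 →
      ¬ I.pathRel x y β.toPath p ∧ ¬ (I.comap (unip t)).pathRel x y β.toPath p) :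
    I.comap (unip t) = I := by
  obtain ⟨J, hJ⟩ : ∃ J, J = I.comap (unip t) := ⟨_, rfl⟩
  rw [← hJ]
  have hmem : ∀ {x y : V} (f : PathHom k x y),
      f ∈ J.hom x y ↔ functorOfArrows (unip t) x y f ∈ I.hom x y := fun f => by
    rw [hJ, mem_comap]
  rw [← hJ] at h
  have hneg : ∀ {x y : V} (f : PathHom k x y) (L : Submodule k (PathHom k x y)),
      (∀ g ∈ L, deriv t x y g ∈ L) → deriv t x y (deriv t x y f) ∈ L →
      functorOfArrows (unip (-t)) x y f - f + deriv t x y f ∈ L := by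
    intro x y f L hL hf
    have := functorOfArrows_unip_sub_mem hdb ht.neg f L
      (fun g hg => by rw [PathHom.deriv_neg]; exact neg_mem (hL g hg))
      (by rw [PathHom.deriv_neg, PathHom.deriv_neg, map_neg, neg_neg]; exact hf)
    rwa [PathHom.deriv_neg, sub_neg_eq_add] at this
  -- A term of the derivation differs from `p` by one substitution `β ↦ r`, so by cancellation it
  -- stays outside the class of `p` for both relations.
  have hoff : ∀ {x y : V} (p q : Quiver.Path x y), deriv t x y (Finsupp.single p 1) q ≠ 0 →
      bypassWeight q < bypassWeight p ∧ ¬ J.pathRel x y q p ∧ ¬ I.pathRel x y q p := by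
    intro x y p q hpq
    rw [PathHom.deriv_single, one_smul] at hpq
    refine ⟨bypassWeight_lt_of_derivOnPath hdb ht hpq, ?_⟩
    obtain ⟨z, z', β, a, r, b, htr, rfl, rfl⟩ := exists_of_derivOnPath_apply_ne_zero hpq
    exact ⟨fun hc => (h β r htr).2 (HomotopyRel.symm (pathRel_of_comp_comp a b hc)),
      fun hc => (h β r htr).1 (HomotopyRel.symm (pathRel_of_comp_comp a b hc))⟩
  have hright : ∀ {x y : V} (f : PathHom k x y),
      functorOfArrows (unip t) x y (functorOfArrows (unip (-t)) x y f) = f :=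
    fun f => functorOfArrows_unip_neg hdb ht f
  have key : ∀ {x y : V}, ∀ f ∈ J.hom x y, deriv t x y f ∈ J.hom x y := by
    intro x y
    exact map_mem_of_isHomogeneousFor (J.pathRel_equivalence x y) (I.pathRel_equivalence x y)
      bypassWeight (fun p q hpq => (hoff p q hpq).1) (fun p q hpq => (hoff p q hpq).2.1)
      (fun p q hpq => (hoff p q hpq).2.2)
      (fun f L => functorOfArrows_unip_sub_mem hdb ht f L) (fun f L => hneg f L) hright
      (J.isHomogeneousFor_pathRel x y) (I.isHomogeneousFor_pathRel x y) hmem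
  -- With `L` the ideal `J` itself, the exponentials of the derivation and of its opposite both
  -- preserve `J`.
  refine ext_hom fun x y => le_antisymm (fun f hf => ?_) fun f hf => ?_
  · have h1 := add_mem (sub_mem (hneg f _ key (key _ (key f hf))) (key f hf)) hf
    rw [add_sub_cancel_right, sub_add_cancel] at h1
    have h2 := (hmem _).1 h1
    rwa [hright] at h2
  · have h1 : functorOfArrows (unip (-t)) x y f ∈ J.hom x y := by
      rw [hmem, hright]
      exact hf
    have h2 := add_mem (add_mem (functorOfArrows_unip_sub_mem hdb ht _ _ key (key _ (key _ h1)))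
      (key _ h1)) h1
    rwa [sub_add_cancel, sub_add_cancel, hright] at h2

theorem exists_length_of_finite [Finite V] (hfin : ∀ x y : V, Finite (Quiver.Path x y))
    (I : PathIdeal k V) (x : V) : ∃ n : ℕ, 2 ≤ n ∧ ∀ y : V,
      (∀ p : Quiver.Path x y, n ≤ p.length → Finsupp.single p (1 : k) ∈ I.hom x y) ∧
      (∀ p : Quiver.Path y x, n ≤ p.length → Finsupp.single p (1 : k) ∈ I.hom y x) := by
  have hb : ∀ a b : V, ∃ n, ∀ p : Quiver.Path a b, p.length < n := by
    intro a b
    have := hfin a b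
    obtain ⟨N, hN⟩ := (Set.finite_range fun p : Quiver.Path a b => p.length).bddAbove
    exact ⟨N + 1, fun p => Nat.lt_succ_of_le (hN ⟨p, rfl⟩)⟩
  choose n hn using hb
  obtain ⟨N, hN⟩ := (Set.finite_range fun a : V × V => n a.1 a.2).bddAbove
  -- Every path is shorter than `N`, so both conditions are vacuous; the summand `2` secures `2 ≤
  -- n`.
  refine ⟨N + 2, by omega, fun y => ⟨fun p hp => ?_, fun p hp => ?_⟩⟩
  · have h1 := hn x y p
    have h2 : n x y ≤ N := hN ⟨(x, y), rfl⟩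
    omega
  · have h1 := hn y x p
    have h2 : n y x ≤ N := hN ⟨(y, x), rfl⟩
    omega

theorem IsAdmissible.comap (hdb : NoDoubleBypass V) [Finite V]
    (hfin : ∀ x y : V, Finite (Quiver.Path x y))
    {F G : ∀ a : (Σ x y : V, x ⟶ y), PathHom k a.1 a.2.1}
    (hGF : ∀ {x y : V} (f : PathHom k x y), functorOfArrows G x y (functorOfArrows F x y f) = f)
    {I : PathIdeal k V} (hI : I.IsAdmissible) : (I.comap F).IsAdmissible where
  two_le_length := by
    intro x y r hr p hp
    rw [Finsupp.mem_support_iff, ← hGF r] at hp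
    obtain ⟨q, hq, hqp⟩ := exists_of_map_apply_ne_zero hp
    rw [functorOfArrows_single, one_smul] at hqp
    refine (hI.two_le_length _ hr q (Finsupp.mem_support_iff.2 hq)).trans ?_
    -- Writing `r = G (F r)` with `F r ∈ I`, it suffices that `G` never shortens a path; on arrows
    -- this holds because every bypass has length at least two.
    refine rel_of_onPath_apply_ne_zero G (R := fun x y p q => p.length ≤ q.length)
      (fun _ => le_rfl) (fun p q β r hp hr => ?_) (fun {x y} β r _ => ?_) q p hqp
    · rw [Quiver.Path.length_cons, Quiver.Path.length_comp]
      rw [Quiver.Path.length_toPath] at hr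
      omega
    · by_cases hb : IsBypass β r
      · have := hdb.two_le_length hb
        rw [Quiver.Path.length_toPath]
        omega
      · unfold IsBypass at hb
        push Not at hb
        rw [hb]
  exists_length := exists_length_of_finite hfin _

end PathIdeal

/-! ## Presentations -/

section Presentations

open PathHom PathIdeal

variable {k : Type w} [Field k] {A : Type z} [Ring A] [Algebra k A] {V : Type u} [Quiver.{v} V]
  {e : V → A}

/-- The ideal `I` is the kernel of a full functor `kQ → A` that is the identity on the objects. -/
def IsPresentationKernel (e : V → A) (I : PathIdeal k V) : Prop :=
  ∃ Ψ : ∀ x y : V, PathHom k x y →ₗ[k] A,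
    (∀ x, Ψ x x (Finsupp.single Quiver.Path.nil 1) = e x) ∧
    (∀ {x y z : V} (f : PathHom k x y) (g : PathHom k y z),
      Ψ x z (f.comp g) = Ψ y z g * Ψ x y f) ∧
    (∀ x y, LinearMap.ker (Ψ x y) = I.hom x y) ∧
    ∀ x y, LinearMap.range (Ψ x y) = corner k e x y

/-- By the first isomorphism theorem, quotients can be replaced by kernels of full functors, which
compose directly with endofunctors of `kQ`. -/
theorem nonempty_presentation_iff {I : PathIdeal k V} :
    Nonempty (Presentation e I) ↔ IsPresentationKernel e I := by
  constructor
  · rintro ⟨P⟩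
    refine ⟨fun x y => (corner k e x y).subtype ∘ₗ (P.equiv x y).toLinearMap ∘ₗ (I.hom x y).mkQ,
      P.map_id, P.map_comp, fun x y => ?_, fun x y => ?_⟩
    · ext f
      simp
    · rw [LinearMap.range_comp, LinearMap.range_eq_top.2, Submodule.map_top, Submodule.range_subtype]
      exact (P.equiv x y).surjective.comp (Submodule.mkQ_surjective _)
  · rintro ⟨Ψ, h1, h2, h3, h4⟩
    refine ⟨⟨fun x y => (Submodule.quotEquivOfEq _ _ (h3 x y).symm).trans
      ((LinearMap.quotKerEquivRange (Ψ x y)).trans (LinearEquiv.ofEq _ _ (h4 x y))),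
      fun x => h1 x, fun f g => h2 f g⟩⟩

theorem IsPresentationKernel.comap {F G : ∀ a : (Σ x y : V, x ⟶ y), PathHom k a.1 a.2.1}
    (hFG : ∀ {x y : V} (f : PathHom k x y), functorOfArrows F x y (functorOfArrows G x y f) = f)
    {I : PathIdeal k V} (hI : IsPresentationKernel e I) : IsPresentationKernel e (I.comap F) := by
  obtain ⟨Ψ, h1, h2, h3, h4⟩ := hI
  refine ⟨fun x y => Ψ x y ∘ₗ functorOfArrows F x y, fun x => ?_, fun f g => ?_, fun x y => ?_,
    fun x y => ?_⟩
  · rw [LinearMap.comp_apply, functorOfArrows_single, one_smul, onPath_nil, h1]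
  · simp only [LinearMap.comp_apply, functorOfArrows_comp, h2]
  · rw [LinearMap.ker_comp, h3]
    rfl
  · rw [LinearMap.range_comp, LinearMap.range_eq_top.2 fun f => ⟨_, hFG f⟩, Submodule.map_top, h4]

/-- Two kernels of functors onto `A` are related by a functor `kQ → kQ`. -/
theorem IsPresentationKernel.exists_lift {I J : PathIdeal k V} (hI : IsPresentationKernel e I)
    (hJ : IsPresentationKernel e J) :
    ∃ F G : ∀ a : (Σ x y : V, x ⟶ y), PathHom k a.1 a.2.1, I = J.comap F ∧
      ∀ {x y : V} (f : PathHom k x y),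
        functorOfArrows G x y (functorOfArrows F x y f) - f ∈ I.hom x y := by
  obtain ⟨Ψ, h1, h2, h3, h4⟩ := hI
  obtain ⟨Φ, g1, g2, g3, g4⟩ := hJ
  -- Both functors have the same ranges, so the image of each arrow under one is hit by the other;
  -- `kQ` being free, a choice on arrows extends to a functor.
  have lift : ∀ (Ψ Φ : ∀ x y : V, PathHom k x y →ₗ[k] A)
      (_ : ∀ x, Ψ x x (Finsupp.single Quiver.Path.nil 1) = e x)
      (_ : ∀ x, Φ x x (Finsupp.single Quiver.Path.nil 1) = e x)
      (_ : ∀ {x y z : V} (f : PathHom k x y) (g : PathHom k y z),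
        Ψ x z (f.comp g) = Ψ y z g * Ψ x y f)
      (_ : ∀ {x y z : V} (f : PathHom k x y) (g : PathHom k y z),
        Φ x z (f.comp g) = Φ y z g * Φ x y f)
      (_ : ∀ x y, LinearMap.range (Ψ x y) = LinearMap.range (Φ x y)),
      ∃ F : ∀ a : (Σ x y : V, x ⟶ y), PathHom k a.1 a.2.1, ∀ (x y : V) (f : PathHom k x y),
        Φ x y (functorOfArrows F x y f) = Ψ x y f := by
    intro Ψ Φ h1 g1 h2 g2 hr
    have hex : ∀ a : (Σ x y : V, x ⟶ y), ∃ f : PathHom k a.1 a.2.1,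
        Φ _ _ f = Ψ _ _ (Finsupp.single a.2.2.toPath 1) := fun a => by
      rw [← LinearMap.mem_range, ← hr]
      exact ⟨_, rfl⟩
    choose F hF using hex
    refine ⟨F, fun x y f => ?_⟩
    have hp : ∀ {x y : V} (p : Quiver.Path x y),
        Φ x y (onPath F p) = Ψ x y (Finsupp.single p 1) := by
      intro x y p
      induction p with
      | nil => rw [onPath_nil, h1, g1]
      | @cons y z p β ih =>
        rw [onPath_cons, g2, ih, hF ⟨y, z, β⟩, ← h2, single_comp_single, mul_one,
          Quiver.Path.comp_toPath_eq_cons]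
    induction f using Finsupp.induction_linear with
    | zero => simp only [map_zero]
    | add f f' hf hf' => simp only [map_add, hf, hf']
    | single p a =>
      rw [functorOfArrows_single, map_smul, hp, ← map_smul, Finsupp.smul_single, smul_eq_mul,
        mul_one]
  obtain ⟨F, hF⟩ := lift Ψ Φ h1 g1 h2 g2 fun x y => by rw [h4, g4]
  obtain ⟨G, hG⟩ := lift Φ Ψ g1 h1 g2 h2 fun x y => by rw [h4, g4]
  refine ⟨F, G, ext_hom fun x y => ?_, fun f => ?_⟩
  · ext f
    rw [mem_comap, ← g3, ← h3, LinearMap.mem_ker, LinearMap.mem_ker, hF]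
  · rw [← h3, LinearMap.mem_ker, map_sub, hG, hF, sub_self]

/-- The values on the arrows of the functor `β ↦ c β • β`. -/
def dilatation (c : (Σ x y : V, x ⟶ y) → k) : ∀ a : (Σ x y : V, x ⟶ y), PathHom k a.1 a.2.1 :=
  fun a => Finsupp.single a.2.2.toPath (c a)

/-- A dilatation multiplies each path by a scalar, so it respects classes, and so does its inverse.
-/
theorem homotopyRel_comap_dilatation {c : (Σ x y : V, x ⟶ y) → k} (hc : ∀ a, c a ≠ 0)
    (I : PathIdeal k V) : HomotopyRel (I.comap (dilatation c)) = HomotopyRel I := by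
  have hle : ∀ (c : (Σ x y : V, x ⟶ y) → k) (I : PathIdeal k V) {x y : V} {p q : QuiverWalk x y},
      HomotopyRel (I.comap (dilatation c)) x y p q → HomotopyRel I x y p q := by
    intro c I x y p q
    refine homotopyRel_of_comap fun {x y} β r hr => ?_
    obtain rfl : r = β.toPath := by
      by_contra hne
      exact hr (Finsupp.single_eq_of_ne hne)
    exact .refl _
  have hinv : (I.comap (dilatation c)).comap (dilatation fun a => (c a)⁻¹) = I := by
    rw [comap_comap]
    convert I.comap_id using 2
    funext a
    change functorOfArrows (dilatation c) a.1 a.2.1 (Finsupp.single a.2.2.toPath _) = _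
    rw [functorOfArrows_single, onPath_toPath]
    change _ • Finsupp.single _ (c a) = _
    rw [Finsupp.smul_single, smul_eq_mul, inv_mul_cancel₀ (hc a)]
  funext x y p q
  refine propext ⟨hle c I, fun h => hle (fun a => (c a)⁻¹) _ ?_⟩
  rwa [hinv]

/-- The other paths parallel to `β` are rigid, so `G` only rescales them and they contribute nothing
to the coefficient of `β`. -/
theorem functorOfArrows_apply_toPath (hdb : NoDoubleBypass V)
    (G : ∀ a : (Σ x y : V, x ⟶ y), PathHom k a.1 a.2.1) {x y : V} (β : x ⟶ y)
    (f : PathHom k x y) :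
    functorOfArrows G x y f β.toPath = f β.toPath * G ⟨x, y, β⟩ β.toPath := by
  induction f using Finsupp.induction_linear with
  | zero => simp only [map_zero, Finsupp.zero_apply, zero_mul]
  | add f f' hf hf' => simp only [map_add, Finsupp.add_apply, hf, hf', add_mul]
  | single p a =>
    rw [functorOfArrows_single, Finsupp.smul_apply, smul_eq_mul]
    by_cases hp : p = β.toPath
    · rw [hp, onPath_toPath, Finsupp.single_eq_same]
    · obtain ⟨c, hc, -⟩ := exists_onPath_eq_of_isRigidPath G (hdb.isRigidPath (α := β) hp)
      rw [hc, Finsupp.single_eq_of_ne (Ne.symm hp), Finsupp.single_eq_of_ne (Ne.symm hp), mul_zero,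
        zero_mul]

/-- Up to a dilatation, two admissible presentations are related by a unipotent functor. -/
theorem exists_homotopyRel_eq_comap_unip (hdb : NoDoubleBypass V) {I J : PathIdeal k V}
    (hIa : I.IsAdmissible) (hI : IsPresentationKernel e I) (hJ : IsPresentationKernel e J) :
    ∃ t : ∀ a : (Σ x y : V, x ⟶ y), PathHom k a.1 a.2.1, IsBypassFamily t ∧
      HomotopyRel I = HomotopyRel (J.comap (unip t)) := by
  obtain ⟨F, G, hIJ, hGF⟩ := hI.exists_lift hJ
  let c : (Σ x y : V, x ⟶ y) → k := fun a => F a a.2.2.toPath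
  -- If `c` vanished at `β`, then `G (F β) - β ∈ I` would have coefficient `-1` at `β`, which
  -- admissibility forbids.
  have hc : ∀ a, c a ≠ 0 := by
    rintro ⟨x, y, β⟩ h0
    have hmem := hGF (Finsupp.single β.toPath 1)
    have h1 : (functorOfArrows G x y (functorOfArrows F x y (Finsupp.single β.toPath 1)) -
        Finsupp.single β.toPath 1 : PathHom k x y) β.toPath = -1 := by
      rw [Finsupp.sub_apply, functorOfArrows_apply_toPath hdb, functorOfArrows_apply_toPath hdb,
        Finsupp.single_eq_same, show F ⟨x, y, β⟩ β.toPath = 0 from h0]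
      simp
    have := hIa.two_le_length _ hmem β.toPath (by rw [Finsupp.mem_support_iff, h1]; simp)
    rw [Quiver.Path.length_toPath] at this
    omega
  let t : ∀ a : (Σ x y : V, x ⟶ y), PathHom k a.1 a.2.1 := fun a =>
    (c a)⁻¹ • F a - Finsupp.single a.2.2.toPath 1
  have ht : IsBypassFamily t := by
    intro x y β
    change (c ⟨x, y, β⟩)⁻¹ * c ⟨x, y, β⟩ - (Finsupp.single β.toPath 1 : PathHom k x y) β.toPath = 0
    rw [inv_mul_cancel₀ (hc _), Finsupp.single_eq_same, sub_self]
  refine ⟨t, ht, ?_⟩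
  -- `F a = c a • (a + t a)`: the lift is a dilatation followed by a unipotent functor.
  have hFt : I = (J.comap (unip t)).comap (dilatation c) := by
    rw [comap_comap, hIJ]
    congr 1
    funext a
    change _ = functorOfArrows (unip t) a.1 a.2.1 (Finsupp.single a.2.2.toPath (c a))
    rw [functorOfArrows_single, onPath_toPath]
    change F a = c a • (Finsupp.single a.2.2.toPath 1 + ((c a)⁻¹ • F a - _))
    rw [add_sub_cancel, smul_smul, mul_inv_cancel₀ (hc a), one_smul]
  rw [hFt, homotopyRel_comap_dilatation hc]

end Presentations

/-! ## Sources of the quiver of homotopy relations -/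

section Sources

open PathHom PathIdeal

variable {k : Type w} [Field k] {A : Type z} [Ring A] [Algebra k A] {V : Type u} [Quiver.{v} V]
  {e : V → A}

open Classical in
/-- The family concentrated at the arrow `α`, with value `τ u`. -/
def bypassSingle {a b : V} (α : a ⟶ b) (p : Quiver.Path a b) (τ : k) :
    ∀ c : (Σ x y : V, x ⟶ y), PathHom k c.1 c.2.1 :=
  Pi.single ⟨a, b, α⟩ (Finsupp.single p τ)

theorem bypassSingle_apply_ne_zero {a b x y : V} {α : a ⟶ b} {p : Quiver.Path a b} {τ : k}
    {β : x ⟶ y} {q : Quiver.Path x y} (h : bypassSingle α p τ ⟨x, y, β⟩ q ≠ 0) :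
    (⟨x, y, β, q⟩ : Σ (x y : V) (_ : x ⟶ y), Quiver.Path x y) = ⟨a, b, α, p⟩ := by
  classical
  unfold bypassSingle at h
  by_cases hβ : (⟨x, y, β⟩ : Σ x y : V, x ⟶ y) = ⟨a, b, α⟩
  · cases hβ
    rw [Pi.single_eq_same] at h
    obtain rfl : q = p := by
      by_contra hne
      exact h (Finsupp.single_eq_of_ne hne)
    rfl
  · rw [Pi.single_eq_of_ne hβ] at h
    exact absurd rfl h

theorem isBypassFamily_bypassSingle {a b : V} {α : a ⟶ b} {p : Quiver.Path a b}
    (h : IsBypass α p) (τ : k) : IsBypassFamily (bypassSingle α p τ) := by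
  intro x y β
  by_contra hne
  have := bypassSingle_apply_ne_zero hne
  cases this
  exact h rfl

theorem transvection_eq {a b : V} (α : a ⟶ b) (p : Quiver.Path a b) (τ : k) (x y : V) :
    transvection α p τ x y = functorOfArrows (unip (bypassSingle α p τ)) x y := by
  classical
  unfold transvection
  congr 1
  funext c
  unfold unip bypassSingle
  by_cases hc : c = ⟨a, b, α⟩
  · subst hc
    rw [Function.update_self, Pi.single_eq_same, Finsupp.smul_single, smul_eq_mul, mul_one]
  · rw [Function.update_of_ne hc, Pi.single_eq_of_ne hc, add_zero]

/-- Transvections being invertible, direct images in the definition of successors can be traded for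
inverse images. -/
theorem hom_eq_map_transvection_iff (hdb : NoDoubleBypass V) {a b : V} {α : a ⟶ b}
    {p : Quiver.Path a b} (h : IsBypass α p) (τ : k) (I J : PathIdeal k V) :
    (∀ x y, J.hom x y = (I.hom x y).map (transvection α p τ x y)) ↔
      I = J.comap (unip (bypassSingle α p τ)) := by
  have ht : IsBypassFamily (bypassSingle α p τ) := isBypassFamily_bypassSingle h τ
  have hinv : ∀ {x y : V} (f : PathHom k x y), functorOfArrows (unip (bypassSingle α p τ)) x y
      (functorOfArrows (unip (-bypassSingle α p τ)) x y f) = f :=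
    functorOfArrows_unip_neg hdb ht
  have hinv' : ∀ {x y : V} (f : PathHom k x y), functorOfArrows (unip (-bypassSingle α p τ)) x y
      (functorOfArrows (unip (bypassSingle α p τ)) x y f) = f := fun f => by
    have := functorOfArrows_unip_neg hdb ht.neg f
    rwa [neg_neg] at this
  simp only [transvection_eq]
  constructor
  · intro hJ
    refine ext_hom fun x y => ?_
    ext f
    rw [mem_comap, hJ, Submodule.mem_map]
    constructor
    · exact fun hf => ⟨f, hf, rfl⟩
    · rintro ⟨g, hg, hgf⟩
      rw [← hinv' f, ← hgf, hinv']
      exact hg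
  · rintro rfl x y
    ext f
    rw [Submodule.mem_map]
    constructor
    · exact fun hf => ⟨_, mem_comap.2 (by rw [hinv]; exact hf), hinv f⟩
    · rintro ⟨g, hg, rfl⟩
      exact hg

theorem homotopyRel_of_comap_unip {t : ∀ a : (Σ x y : V, x ⟶ y), PathHom k a.1 a.2.1}
    {I : PathIdeal k V}
    (h : ∀ {x y : V} (β : x ⟶ y) (p : Quiver.Path x y), t ⟨x, y, β⟩ p ≠ 0 →
      I.pathRel x y β.toPath p) {x y : V} {p q : QuiverWalk x y}
    (hpq : HomotopyRel (I.comap (unip t)) x y p q) : HomotopyRel I x y p q := by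
  refine homotopyRel_of_comap (fun {x y} β r hr => ?_) hpq
  by_cases hrβ : r = β.toPath
  · rw [hrβ]
    exact .refl _
  · refine h β r fun h0 => hr ?_
    rw [unip, Finsupp.add_apply, h0, Finsupp.single_eq_of_ne hrβ, add_zero]

/-- An arrow of the quiver of homotopy relations goes from a strictly finer relation to a
coarser one. -/
theorem IsDirectSuccessor.lt (hdb : NoDoubleBypass V) {R S : WalkRel V}
    (h : IsDirectSuccessor k R S) : R < S := by
  obtain ⟨I, J, a, b, α, p, τ, -, -, rfl, rfl, hb, hJ, hI, hJp⟩ := h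
  rw [hom_eq_map_transvection_iff hdb hb] at hJ
  refine lt_of_le_not_ge (fun x y q r hqr => ?_) fun hle => hI (hle a b _ _ hJp)
  rw [hJ] at hqr
  refine homotopyRel_of_comap_unip (fun β q hq => ?_) hqr
  have := bypassSingle_apply_ne_zero hq
  cases this
  exact hJp

/-- Nothing lies strictly below a minimal relation, so no arrow can end there. -/
theorem exists_isQuiverSource (hdb : NoDoubleBypass V) [Finite (HomotopyQuiver k e)]
    [Nonempty (HomotopyQuiver k e)] : ∃ R : HomotopyQuiver k e, IsQuiverSource R := by
  obtain ⟨R, hR⟩ := (Set.finite_range fun R : HomotopyQuiver k e => R.1).exists_minimal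
    (Set.range_nonempty _)
  obtain ⟨R, rfl⟩ := hR.1
  exact ⟨R, fun S => ⟨fun h => (h.down.lt hdb).not_ge (hR.2 ⟨S, rfl⟩ (h.down.lt hdb).le)⟩⟩

/-- The ideals of the admissible presentations with homotopy relation `R`. -/
def IsPresentedWith (e : V → A) (R : WalkRel V) (I : PathIdeal k V) : Prop :=
  I.IsAdmissible ∧ IsPresentationKernel e I ∧ HomotopyRel I = R

variable [Finite V]

theorem isAdmissible_comap_unip (hdb : NoDoubleBypass V)
    (hfin : ∀ x y : V, Finite (Quiver.Path x y))
    {t : ∀ a : (Σ x y : V, x ⟶ y), PathHom k a.1 a.2.1} (ht : IsBypassFamily t)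
    {I : PathIdeal k V} (hI : I.IsAdmissible) : (I.comap (unip t)).IsAdmissible :=
  hI.comap hdb hfin (G := unip (-t)) fun f => by
    have := functorOfArrows_unip_neg hdb ht.neg f
    rwa [neg_neg] at this

/-- At a source, a transvection along homotopic paths does not change the homotopy relation. -/
theorem homotopyRel_comap_bypassSingle_of_isQuiverSource (hdb : NoDoubleBypass V)
    (hfin : ∀ x y : V, Finite (Quiver.Path x y)) {R : HomotopyQuiver k e}
    (hR : IsQuiverSource R) {I : PathIdeal k V} (hI : IsPresentedWith e R.1 I)
    {a b : V} {α : a ⟶ b} {p : Quiver.Path a b} (hp : IsBypass α p)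
    (hαp : I.pathRel a b α.toPath p) (τ : k) :
    IsPresentedWith e R.1 (I.comap (unip (bypassSingle α p τ))) := by
  set t := bypassSingle α p τ with ht_def
  have ht : IsBypassFamily t := isBypassFamily_bypassSingle hp τ
  have hadm := isAdmissible_comap_unip hdb hfin ht hI.1
  have hpres : IsPresentationKernel e (I.comap (unip t)) :=
    hI.2.1.comap (G := unip (-t)) fun f => functorOfArrows_unip_neg hdb ht f
  refine ⟨hadm, hpres, ?_⟩
  -- Otherwise the relation of the inverse image has `R` as a direct successor, although `R` is a
  -- source.
  have hα : (I.comap (unip t)).pathRel a b α.toPath p := by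
    by_contra hc
    let S : HomotopyQuiver k e :=
      ⟨HomotopyRel (I.comap (unip t)), _, hadm, nonempty_presentation_iff.2 hpres, rfl⟩
    refine (hR S).false ⟨I.comap (unip t), I, a, b, α, p, τ, hadm, hI.1, rfl, hI.2.2.symm, hp, ?_,
      hc, hαp⟩
    exact (hom_eq_map_transvection_iff hdb hp τ _ _).2 rfl
  rw [← hI.2.2]
  funext x y q r
  -- Since `α` and `p` are homotopic for both ideals, the transvection and its inverse respect the
  -- classes, giving the two inclusions.
  refine propext ⟨homotopyRel_of_comap_unip fun β q hq => ?_, fun h => ?_⟩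
  · have := bypassSingle_apply_ne_zero hq
    cases this
    exact hαp
  · rw [← comap_unip_neg_comap hdb ht I] at h
    refine homotopyRel_of_comap_unip (fun β q hq => ?_) h
    rw [Pi.neg_apply, Finsupp.neg_apply, neg_ne_zero] at hq
    have := bypassSingle_apply_ne_zero hq
    cases this
    exact hα

/-- At a source, a unipotent functor along homotopic paths does not change the homotopy
relation. -/
theorem homotopyRel_comap_unip_of_isQuiverSource (hdb : NoDoubleBypass V)
    (hfin : ∀ x y : V, Finite (Quiver.Path x y)) (hhom : ∀ x y : V, Finite (x ⟶ y))
    {R : HomotopyQuiver k e} (hR : IsQuiverSource R) {I : PathIdeal k V}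
    (hI : IsPresentedWith e R.1 I) {t : ∀ a : (Σ x y : V, x ⟶ y), PathHom k a.1 a.2.1}
    (ht : IsBypassFamily t)
    (h : ∀ {x y : V} (β : x ⟶ y) (p : Quiver.Path x y), t ⟨x, y, β⟩ p ≠ 0 →
      I.pathRel x y β.toPath p) : IsPresentedWith e R.1 (I.comap (unip t)) := by
  classical
  have := Fintype.ofFinite (Σ x y : V, x ⟶ y)
  have hsum : t = ∑ a, ∑ p ∈ (t a).support, bypassSingle a.2.2 p (t a p) := by
    have h1 : t = ∑ a, Pi.single a (t a) := (Finset.univ_sum_single t).symm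
    conv_lhs => rw [h1]
    refine Finset.sum_congr rfl fun a _ => ?_
    conv_lhs => rw [← Finsupp.sum_single (t a), Finsupp.sum]
    exact map_sum (AddMonoidHom.single _ a) _ _
  -- `Q` quantifies over all ideals presenting `R`, so that transvections can be applied one after
  -- another while the ideal changes.
  let Q : (∀ a : (Σ x y : V, x ⟶ y), PathHom k a.1 a.2.1) → Prop := fun t =>
    IsBypassFamily t ∧ ∀ I, IsPresentedWith e R.1 I → IsPresentedWith e R.1 (I.comap (unip t))
  have hQ0 : Q 0 := ⟨fun β => rfl, fun I hI => by rwa [comap_unip_zero]⟩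
  have hQadd : ∀ s t, Q s → Q t → Q (s + t) := fun s t hs ht =>
    ⟨IsBypassFamily.add hs.1 ht.1, fun I hI => by
      rw [comap_unip_add hdb hs.1 ht.1]
      exact ht.2 _ (hs.2 _ hI)⟩
  have hQ : Q t := by
    rw [hsum]
    refine Finset.sum_induction _ Q hQadd hQ0 fun a _ =>
      Finset.sum_induction _ Q hQadd hQ0 fun p hp => ?_
    obtain ⟨x, y, β⟩ := a
    rw [Finsupp.mem_support_iff] at hp
    have hb : IsBypass β p := ht.isBypass hp
    refine ⟨isBypassFamily_bypassSingle hb _, fun J hJ => ?_⟩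
    refine homotopyRel_comap_bypassSingle_of_isQuiverSource hdb hfin hR hJ hb ?_ _
    have := h β p hp
    unfold pathRel at this ⊢
    rwa [hJ.2.2, ← hI.2.2]
  exact hQ.2 I hI

theorem isQuiverSource_unique [CharZero k] (hdb : NoDoubleBypass V)
    (hfin : ∀ x y : V, Finite (Quiver.Path x y)) (hhom : ∀ x y : V, Finite (x ⟶ y))
    {R S : HomotopyQuiver k e} (hR : IsQuiverSource R) (hS : IsQuiverSource S) : R = S := by
  classical
  obtain ⟨I, hIa, hIp, hIR⟩ := R.2
  obtain ⟨J, hJa, hJp, hJS⟩ := S.2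
  rw [nonempty_presentation_iff] at hIp hJp
  obtain ⟨t, ht, hIt⟩ := exists_homotopyRel_eq_comap_unip hdb hJa hJp hIp
  have hI : IsPresentedWith e R.1 I := ⟨hIa, hIp, hIR.symm⟩
  have hJ : IsPresentedWith e S.1 (I.comap (unip t)) :=
    ⟨isAdmissible_comap_unip hdb hfin ht hIa,
      hIp.comap (G := unip (-t)) fun f => functorOfArrows_unip_neg hdb ht f, by rw [hJS, hIt]⟩
  let rel : WalkRel V → ∀ {x y : V}, (x ⟶ y) → Quiver.Path x y → Prop := fun T x y β p =>
    T x y (QuiverWalk.ofPath β.toPath) (QuiverWalk.ofPath p)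
  let cut : (∀ {x y : V}, (x ⟶ y) → Quiver.Path x y → Prop) →
      ∀ a : (Σ x y : V, x ⟶ y), PathHom k a.1 a.2.1 := fun C a => coordPart (C a.2.2) (t a)
  have hcut : ∀ C : (∀ {x y : V}, (x ⟶ y) → Quiver.Path x y → Prop), IsBypassFamily (cut C) ∧
      ∀ {x y : V} (β : x ⟶ y) (p : Quiver.Path x y), cut C ⟨x, y, β⟩ p ≠ 0 → C β p := by
    intro C
    refine ⟨fun {x y} β => ?_, fun {x y} β p hp => ?_⟩
    · change coordPart (C β) (t ⟨x, y, β⟩) β.toPath = 0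
      rw [coordPart_apply, ht β, ite_self]
    · by_contra hc
      change coordPart (C β) (t ⟨x, y, β⟩) p ≠ 0 at hp
      rw [coordPart_apply, if_neg hc] at hp
      exact hp rfl
  -- `t` is split into a part homotopic at `R`, a part homotopic at `S`, and the rest
  let t₁ := cut fun β p => rel R.1 β p
  let t₂ := cut fun β p => ¬ rel R.1 β p ∧ rel S.1 β p
  let t₃ := cut fun β p => ¬ rel R.1 β p ∧ ¬ rel S.1 β p
  have h₁ := hcut fun β p => rel R.1 β p
  have h₂ := hcut fun β p => ¬ rel R.1 β p ∧ rel S.1 β p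
  have h₃ := hcut fun β p => ¬ rel R.1 β p ∧ ¬ rel S.1 β p
  have hsum : t = t₁ + (t₃ + t₂) := by
    funext a
    refine Finsupp.ext fun p => ?_
    change t a p = coordPart _ (t a) p + (coordPart _ (t a) p + coordPart _ (t a) p)
    simp only [coordPart_apply]
    by_cases hr : rel R.1 a.2.2 p <;> by_cases hs : rel S.1 a.2.2 p <;> simp [hr, hs]
  have hI' : IsPresentedWith e R.1 (I.comap (unip t₁)) := by
    refine homotopyRel_comap_unip_of_isQuiverSource hdb hfin hhom hR hI h₁.1 fun β p hp => ?_
    have := h₁.2 β p hp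
    unfold pathRel
    rw [hI.2.2]
    exact this
  have hJ' : IsPresentedWith e S.1 ((I.comap (unip t)).comap (unip (-t₂))) := by
    refine homotopyRel_comap_unip_of_isQuiverSource hdb hfin hhom hS hJ (IsBypassFamily.neg h₂.1) fun β p hp => ?_
    rw [Pi.neg_apply, Finsupp.neg_apply, neg_ne_zero] at hp
    have := (h₂.2 β p hp).2
    unfold pathRel
    rw [hJ.2.2]
    exact this
  -- In `t₁ + (t₃ + t₂)` the inverse image under `t₂` is taken last, so that moving the second ideal
  -- by `-t₂` cancels it and leaves only `t₃` between the two ideals.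
  have hIJ : (I.comap (unip t)).comap (unip (-t₂)) = (I.comap (unip t₁)).comap (unip t₃) := by
    rw [hsum, comap_unip_add hdb h₁.1 (IsBypassFamily.add h₃.1 h₂.1), comap_unip_add hdb h₃.1 h₂.1,
      comap_unip_neg_comap hdb h₂.1]
  rw [hIJ] at hJ'
  have hfix := comap_unip_eq_self hdb hfin h₃.1 (I.comap (unip t₁)) fun β p hp => by
    have := h₃.2 β p hp
    unfold pathRel
    rw [hI'.2.2, hJ'.2.2]
    exact this
  apply Subtype.ext
  rw [← hI'.2.2, ← hJ'.2.2]
  exact congrArg _ hfix.symm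

end Sources

/-! ## Existence of an admissible presentation -/

section Gabriel

open PathHom PathIdeal

variable {k : Type w} [Field k] {A : Type z} [Ring A] [Algebra k A] {V : Type u}

theorem mem_cornerOf {e : V → A} {x y : V} {M : Submodule k A} {a : A} :
    a ∈ cornerOf k e x y M ↔ ∃ m ∈ M, e y * (m * e x) = a := by
  simp [cornerOf, Submodule.mem_map]

theorem mem_radical {a : A} : a ∈ radical k A ↔ a ∈ Ring.jacobson A := Iff.rfl

theorem exists_radical_pow_eq_bot [FiniteDimensional k A] : ∃ n, radical k A ^ n = ⊥ := by
  have : IsArtinianRing A := IsArtinianRing.of_finite k A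
  obtain ⟨n, hn⟩ : IsNilpotent (Ring.jacobson A) := IsSemiprimaryRing.isNilpotent
  refine ⟨n, ?_⟩
  -- Nilpotency holds for powers of the radical as an ideal; powers as a subspace are contained in
  -- them.
  have h : ∀ m, ∀ a ∈ radical k A ^ m, a ∈ Ring.jacobson A ^ m := by
    intro m
    induction m with
    | zero =>
      intro a _
      rw [Submodule.pow_zero, Ideal.one_eq_top]
      exact Submodule.mem_top
    | succ m ih =>
      intro a ha
      rw [pow_succ] at ha
      rw [Submodule.pow_succ]
      refine Submodule.mul_induction_on ha (fun b hb c hc => ?_) fun b c => add_mem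
      exact Ideal.mul_mem_mul (ih b hb) hc
  rw [eq_bot_iff]
  intro a ha
  have := h n a ha
  rw [hn] at this
  exact this

theorem isNilpotent_of_mem_radical [FiniteDimensional k A] {a : A} (ha : a ∈ Ring.jacobson A) :
    IsNilpotent a := by
  obtain ⟨n, hn⟩ := exists_radical_pow_eq_bot (k := k) (A := A)
  refine ⟨n, ?_⟩
  have := Submodule.pow_mem_pow (radical k A) (mem_radical.2 ha) n
  rwa [hn, Submodule.mem_bot] at this

theorem mul_mem_radical_left (a : A) {b : A} (hb : b ∈ radical k A) : a * b ∈ radical k A :=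
  (Ring.jacobson A).mul_mem_left a hb

theorem mul_mem_radical_right {a : A} (b : A) (ha : a ∈ radical k A) : a * b ∈ radical k A :=
  Ideal.mul_mem_right b (Ring.jacobson A) ha

theorem mul_mem_radical_sq_left (a : A) {b : A} (hb : b ∈ radical k A ^ 2) :
    a * b ∈ radical k A ^ 2 := by
  rw [sq] at hb ⊢
  refine Submodule.mul_induction_on hb (fun c hc d hd => ?_) fun c d hc hd => ?_
  · rw [← mul_assoc]
    exact Submodule.mul_mem_mul (mul_mem_radical_left a hc) hd
  · rw [mul_add]
    exact add_mem hc hd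

theorem mul_mem_radical_sq_right {a : A} (b : A) (ha : a ∈ radical k A ^ 2) :
    a * b ∈ radical k A ^ 2 := by
  rw [sq] at ha ⊢
  refine Submodule.mul_induction_on ha (fun c hc d hd => ?_) fun c d hc hd => ?_
  · rw [mul_assoc]
    exact Submodule.mul_mem_mul hc (mul_mem_radical_right b hd)
  · rw [add_mul]
    exact add_mem hc hd

/-- In a basic algebra, the corners at distinct vertices lie in the radical, and the corner at a
vertex is spanned by the idempotent modulo the radical. -/
theorem IsBasicAlgebra.corner_mem [FiniteDimensional k A] [Fintype V]
    (hbasic : IsBasicAlgebra k A) {e : V → A} (he : CompleteOrthogonalIdempotents e)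
    (hprim : ∀ x, IsPrimitiveIdempotent (e x)) :
    (∀ x y, x ≠ y → ∀ a, e y * (a * e x) ∈ radical k A) ∧
      ∀ x a, ∃ c : k, e x * (a * e x) - c • e x ∈ radical k A := by
  obtain ⟨n, ⟨E⟩⟩ := hbasic
  let π : A →ₐ[k] (Fin n → k) := E.toAlgHom.comp (Ideal.Quotient.mkₐ k (Ring.jacobson A))
  have hker : ∀ a, π a = 0 ↔ a ∈ radical k A := by
    intro a
    change E (Ideal.Quotient.mk _ a) = 0 ↔ _
    rw [EmbeddingLike.map_eq_zero_iff, Ideal.Quotient.eq_zero_iff_mem]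
    rfl
  have hsurj : Function.Surjective π :=
    E.surjective.comp Ideal.Quotient.mk_surjective
  constructor
  · intro x y hxy a
    -- The quotient is commutative, so the images of `e y` and `e x` can be brought together, where
    -- they annihilate each other.
    rw [← hker, map_mul, map_mul, mul_left_comm, ← map_mul, he.ortho hxy.symm, map_zero, mul_zero]
  · intro x a
    have hid : ∀ i, π (e x) i = 0 ∨ π (e x) i = 1 := by
      intro i
      have h1 : π (e x) * π (e x) = π (e x) := by rw [← map_mul, (he.idem x).eq]
      have h2 : π (e x) i * π (e x) i = π (e x) i := congrFun h1 i
      rcases eq_or_ne (π (e x) i) 0 with h | h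
      · exact Or.inl h
      · exact Or.inr (mul_left_cancel₀ h (by rw [h2, mul_one]))
    obtain ⟨i, hi⟩ : ∃ i, π (e x) i = 1 := by
      by_contra! hne
      have h0 : π (e x) = 0 := funext fun i => (hid i).resolve_right (hne i)
      rw [hker] at h0
      obtain ⟨m, hm⟩ := isNilpotent_of_mem_radical (k := k) h0
      rcases m with _ | m
      · exact (hprim x).2.1 (by rw [← mul_one (e x), ← pow_zero (e x), hm, mul_zero])
      · rw [(he.idem x).pow_succ_eq] at hm
        exact (hprim x).2.1 hm
    -- Were the image of `e x` nonzero at a second coordinate, the coordinate idempotent at `i`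
    -- would lift to an idempotent `f` with `f * e x = e x * f = f`, splitting `e x` against
    -- primitivity.
    have huniq : ∀ j, j ≠ i → π (e x) j = 0 := by
      intro j hj
      by_contra hj0
      have hj1 := (hid j).resolve_left hj0
      have hd : IsIdempotentElem (Pi.single i 1 : Fin n → k) := by
        funext l
        by_cases hl : l = i
        · subst hl; simp
        · simp [hl]
      have hde : π (e x) * Pi.single i 1 = Pi.single i 1 := by
        funext l
        by_cases hl : l = i
        · subst hl; simp [hi]
        · simp [hl]
      have h1e : π (1 - e x) * (Pi.single i 1 : Fin n → k) = 0 := by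
        rw [map_sub, map_one, sub_mul, one_mul, hde, sub_self]
      obtain ⟨f, hf, hfπ, hf1, hf2⟩ := exists_isIdempotentElem_mul_eq_zero_of_ker_isNilpotent
        (π : A →+* (Fin n → k))
        (fun a ha => isNilpotent_of_mem_radical (k := k) ((hker a).1 ha)) (Pi.single i 1)
        (by obtain ⟨b, hb⟩ := hsurj (Pi.single i 1); exact ⟨b, hb⟩) hd (1 - e x) (he.idem x).one_sub
        (by rw [mul_comm]; exact h1e) h1e
      have hfe : f * e x = f := by
        rw [mul_sub, mul_one, sub_eq_zero] at hf1; exact hf1.symm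
      have hef : e x * f = f := by
        rw [sub_mul, one_mul, sub_eq_zero] at hf2; exact hf2.symm
      have hfπ' : π f = Pi.single i 1 := hfπ
      rcases (hprim x).2.2 f (e x - f) hf
        (by
          rw [IsIdempotentElem, mul_sub, sub_mul, sub_mul, (he.idem x).eq, hfe, hef, hf.eq]
          abel)
        (by rw [mul_sub, hfe, hf.eq, sub_self]) (by rw [sub_mul, hef, hf.eq, sub_self])
        (by abel) with h | h
      · rw [h, map_zero] at hfπ'
        have := congrFun hfπ' i
        simp at this
      · rw [sub_eq_zero.1 h, hfπ'] at hj1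
        simp [hj] at hj1
    refine ⟨π a i, ?_⟩
    rw [← hker]
    funext j
    by_cases hj : j = i
    · subst hj
      simp [hi]
    · simp [huniq j hj]

theorem cornerOf_radical_mem_radical {e : V → A} {x y : V} {a : A}
    (ha : a ∈ cornerOf k e x y (radical k A)) : a ∈ radical k A := by
  obtain ⟨m, hm, rfl⟩ := mem_cornerOf.1 ha
  exact mul_mem_radical_left _ (mul_mem_radical_right _ hm)

theorem eq_of_mem_cornerOf [Fintype V] {e : V → A} (he : CompleteOrthogonalIdempotents e)
    {x y : V} {M : Submodule k A} {a : A} (ha : a ∈ cornerOf k e x y M) :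
    e y * a = a ∧ a * e x = a := by
  obtain ⟨m, -, rfl⟩ := mem_cornerOf.1 ha
  rw [← mul_assoc, (he.idem y).eq, mul_assoc (e y), mul_assoc m, (he.idem x).eq]
  exact ⟨rfl, rfl⟩

/-- Arrows of the ordinary quiver lift to generators of the radical modulo its square. -/
theorem IsOrdinaryQuiver.exists_generator [FiniteDimensional k A] [Fintype V] [Quiver.{v} V]
    {e : V → A} (hQ : IsOrdinaryQuiver k e) (hdb : NoDoubleBypass V) {x y : V} (β : x ⟶ y) :
    ∃ a ∈ cornerOf k e x y (radical k A), a ∉ cornerOf k e x y (radical k A ^ 2) ∧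
      ∀ b ∈ cornerOf k e x y (radical k A),
        ∃ c : k, b - c • a ∈ cornerOf k e x y (radical k A ^ 2) := by
  have hcard : Nat.card (x ⟶ y) = 1 :=
    Nat.card_eq_one_iff_unique.2 ⟨⟨hdb.arrow_eq⟩, ⟨β⟩⟩
  have hrank := hQ.card_hom x y
  rw [hcard] at hrank
  obtain ⟨v, hv0, hv⟩ := finrank_eq_one_iff'.1 hrank.symm
  obtain ⟨a, rfl⟩ := Submodule.mkQ_surjective _ v
  refine ⟨a.1, a.2, fun ha => hv0 ?_, fun b hb => ?_⟩
  · rw [Submodule.mkQ_apply, Submodule.Quotient.mk_eq_zero]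
    exact ha
  · obtain ⟨c, hc⟩ := hv (Submodule.mkQ _ ⟨b, hb⟩)
    refine ⟨c, ?_⟩
    rw [← map_smul, eq_comm, ← sub_eq_zero, ← map_sub, Submodule.mkQ_apply,
      Submodule.Quotient.mk_eq_zero] at hc
    exact hc

theorem IsOrdinaryQuiver.cornerOf_le_of_isEmpty [FiniteDimensional k A] [Fintype V]
    [Quiver.{v} V] {e : V → A} (hQ : IsOrdinaryQuiver k e) {x y : V} [IsEmpty (x ⟶ y)] :
    cornerOf k e x y (radical k A) ≤ cornerOf k e x y (radical k A ^ 2) := by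
  have hrank := hQ.card_hom x y
  rw [Nat.card_of_isEmpty, eq_comm, Module.finrank_zero_iff,
    Submodule.Quotient.subsingleton_iff, Submodule.submoduleOf_eq_top] at hrank
  exact hrank

variable [Quiver.{v} V]

/-- The functor `kQ → A` given by the idempotents `e` and by `g` on the arrows, evaluated at a
path. -/
def evalPath (e : V → A) (g : (Σ x y : V, x ⟶ y) → A) {x : V} :
    ∀ {y : V}, Quiver.Path x y → A
  | _, Quiver.Path.nil => e x
  | _, Quiver.Path.cons p β => g ⟨_, _, β⟩ * evalPath e g p

theorem evalPath_comp {e : V → A} {g : (Σ x y : V, x ⟶ y) → A}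
    (hg : ∀ a, e a.2.1 * g a = g a) (he : ∀ x, e x * e x = e x) {x y z : V}
    (p : Quiver.Path x y) (q : Quiver.Path y z) :
    evalPath e g (p.comp q) = evalPath e g q * evalPath e g p := by
  induction q with
  | nil =>
    change evalPath e g p = e y * evalPath e g p
    cases p with
    | nil => exact (he _).symm
    | cons p β =>
      change g _ * _ = e y * (g _ * _)
      rw [← mul_assoc, hg ⟨_, _, β⟩]
  | cons q β ih =>
    change g _ * evalPath e g (p.comp q) = g _ * _ * _
    rw [ih, mul_assoc]

/-- This is Gabriel's theorem. Arrows are sent to generators of the radical modulo its square. The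
kernel contains no arrow terms because a generator is not in the square, and the functor is full
because idempotents and generators span `A` up to products in ever higher, eventually zero, powers
of the radical. -/
theorem exists_isPresentationKernel [Fintype V] [FiniteDimensional k A] {e : V → A}
    (hbasic : IsBasicAlgebra k A) (hQ : IsOrdinaryQuiver k e) (hdb : NoDoubleBypass V)
    (hfin : ∀ x y : V, Finite (Quiver.Path x y)) :
    ∃ I : PathIdeal k V, I.IsAdmissible ∧ IsPresentationKernel e I := by
  have he := hQ.complete
  obtain ⟨hoff, hdiag⟩ := hbasic.corner_mem he hQ.primitive
  choose g hg hg2 hgen using fun a : (Σ x y : V, x ⟶ y) => hQ.exists_generator hdb a.2.2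
  have hgl : ∀ a, e a.2.1 * g a = g a := fun a => (eq_of_mem_cornerOf he (hg a)).1
  have hgr : ∀ a, g a * e a.1 = g a := fun a => (eq_of_mem_cornerOf he (hg a)).2
  have hgrad : ∀ a, g a ∈ radical k A := fun a => cornerOf_radical_mem_radical (hg a)
  have hcomp : ∀ {x y z : V} (p : Quiver.Path x y) (q : Quiver.Path y z),
      evalPath e g (p.comp q) = evalPath e g q * evalPath e g p :=
    fun p q => evalPath_comp hgl (fun x => (he.idem x).eq) p q
  have hevl : ∀ {x y : V} (p : Quiver.Path x y), e y * evalPath e g p = evalPath e g p :=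
    fun p => (hcomp p Quiver.Path.nil).symm
  have hevr : ∀ {x y : V} (p : Quiver.Path x y), evalPath e g p * e x = evalPath e g p :=
    fun p => by
      have := hcomp Quiver.Path.nil p
      rw [Quiver.Path.nil_comp] at this
      exact this.symm
  let Ψ : ∀ x y : V, PathHom k x y →ₗ[k] A := fun x y =>
    Finsupp.linearCombination k fun p => evalPath e g p
  have hΨ : ∀ {x y : V} (p : Quiver.Path x y) (c : k),
      Ψ x y (Finsupp.single p c) = c • evalPath e g p := fun p c => by simp [Ψ]
  have hΨcomp : ∀ {x y z : V} (f : PathHom k x y) (f' : PathHom k y z),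
      Ψ x z (f.comp f') = Ψ y z f' * Ψ x y f := by
    intro x y z f f'
    induction f using Finsupp.induction_linear with
    | zero => simp only [PathHom.zero_comp, map_zero, mul_zero]
    | add f₁ f₂ h₁ h₂ => simp only [PathHom.add_comp, map_add, h₁, h₂, mul_add]
    | single p a =>
      induction f' using Finsupp.induction_linear with
      | zero => simp only [PathHom.comp_zero, map_zero, zero_mul]
      | add f₁ f₂ h₁ h₂ => simp only [PathHom.comp_add, map_add, h₁, h₂, add_mul]
      | single q b =>
        simp only [single_comp_single, hΨ, hcomp, smul_mul_smul_comm, mul_comm a b]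
  have hΨl : ∀ {x y : V} (f : PathHom k x y), e y * Ψ x y f = Ψ x y f := by
    intro x y f
    have := hΨcomp f (Finsupp.single Quiver.Path.nil 1)
    rw [comp_single_nil, hΨ, one_smul] at this
    exact this.symm
  have hΨr : ∀ {x y : V} (f : PathHom k x y), Ψ x y f * e x = Ψ x y f := by
    intro x y f
    have := hΨcomp (Finsupp.single Quiver.Path.nil 1) f
    rw [single_nil_comp, hΨ, one_smul] at this
    exact this.symm
  let I : PathIdeal k V :=
    { hom := fun x y => LinearMap.ker (Ψ x y)
      comp_mem_left := fun f f' hf => by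
        rw [LinearMap.mem_ker] at hf ⊢
        rw [hΨcomp, hf, mul_zero]
      comp_mem_right := fun f f' hf' => by
        rw [LinearMap.mem_ker] at hf' ⊢
        rw [hΨcomp, hf', zero_mul] }
  have hI : ∀ {x y : V} (f : PathHom k x y), f ∈ I.hom x y ↔ Ψ x y f = 0 := fun f => Iff.rfl
  have htwo : ∀ {x y : V} (p : Quiver.Path x y), 2 ≤ p.length →
      evalPath e g p ∈ radical k A ^ 2 := by
    intro x y p hp
    rcases p with _ | ⟨p, β⟩
    · simp at hp
    rcases p with _ | ⟨p, γ⟩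
    · simp at hp
    · change g _ * (g _ * _) ∈ _
      rw [← mul_assoc]
      refine mul_mem_radical_sq_right _ ?_
      rw [sq]
      exact Submodule.mul_mem_mul (hgrad _) (hgrad _)
  have hadm : I.IsAdmissible := by
    refine ⟨fun {x y} r hr p hp => ?_, exists_length_of_finite hfin I⟩
    rw [hI] at hr
    rw [Finsupp.mem_support_iff] at hp
    by_contra hlt
    rcases p with _ | ⟨p, β⟩
    · have hr' : r = Finsupp.single Quiver.Path.nil (r Quiver.Path.nil) := by
        ext q
        rw [hdb.eq_nil q, Finsupp.single_eq_same]
      rw [hr', hΨ] at hr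
      exact (hQ.primitive x).2.1 ((smul_eq_zero.1 hr).resolve_left hp)
    rcases p with _ | ⟨p, γ⟩
    · change r β.toPath ≠ 0 at hp
      -- All other paths parallel to `β` have length at least two and land in the square; if `r`
      -- maps to zero, so does the generator at `β`.
      have hrest : Ψ x y (r - Finsupp.single β.toPath (r β.toPath)) ∈ radical k A ^ 2 := by
        simp only [Ψ]
        rw [Finsupp.linearCombination_apply]
        refine Submodule.sum_mem _ fun q hq => Submodule.smul_mem _ _ (htwo q ?_)
        rw [Finsupp.mem_support_iff] at hq
        refine hdb.two_le_length (α := β) fun hqβ => hq ?_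
        rw [hqβ, Finsupp.sub_apply, Finsupp.single_eq_same, sub_self]
      have hβ : evalPath e g β.toPath = g ⟨x, y, β⟩ := hgr ⟨x, y, β⟩
      rw [map_sub, hr, hΨ, zero_sub, neg_mem_iff, hβ] at hrest
      have h1 := Submodule.smul_mem _ (r β.toPath)⁻¹ hrest
      rw [smul_smul, inv_mul_cancel₀ hp, one_smul] at h1
      refine hg2 ⟨x, y, β⟩ (mem_cornerOf.2 ⟨_, h1, ?_⟩)
      rw [hgr ⟨x, y, β⟩, hgl ⟨x, y, β⟩]
    · simp only [Quiver.Path.length_cons] at hlt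
      omega
  refine ⟨I, hadm, Ψ, fun x => ?_, fun f f' => hΨcomp f f', fun x y => rfl, fun x y => ?_⟩
  · rw [hΨ, one_smul]
    rfl
  -- the span of the images of all paths
  let S : Submodule k A := ⨆ a : V × V, LinearMap.range (Ψ a.1 a.2)
  have hmemS : ∀ {x y : V} (f : PathHom k x y), Ψ x y f ∈ S := fun {x y} f =>
    Submodule.mem_iSup_of_mem (p := fun a : V × V => LinearMap.range (Ψ a.1 a.2)) (x, y) ⟨f, rfl⟩
  have hzero : ∀ {x y x' y' : V} (f : PathHom k x y) (f' : PathHom k x' y'), y ≠ x' →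
      Ψ x' y' f' * Ψ x y f = 0 := by
    intro x y x' y' f f' hne
    rw [← hΨr f', ← hΨl f, mul_assoc, ← mul_assoc (e x'), he.ortho hne.symm, zero_mul, mul_zero]
  have hSmul : S * S ≤ S := by
    rw [Submodule.mul_le]
    intro a ha b hb
    refine Submodule.iSup_induction _ (motive := fun a => a * b ∈ S) ha ?_ ?_ ?_
    · rintro ⟨x', y'⟩ _ ⟨f', rfl⟩
      refine Submodule.iSup_induction _ (motive := fun b => Ψ x' y' f' * b ∈ S) hb ?_ ?_ ?_
      · rintro ⟨x, y⟩ _ ⟨f, rfl⟩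
        by_cases hy : y = x'
        · subst hy
          change Ψ y y' f' * Ψ x y f ∈ S
          rw [← hΨcomp]
          exact hmemS _
        · change Ψ x' y' f' * Ψ x y f ∈ S
          rw [hzero f f' hy]
          exact zero_mem _
      · rw [mul_zero]
        exact zero_mem _
      · intro c d hc hd
        rw [mul_add]
        exact add_mem hc hd
    · rw [zero_mul]
      exact zero_mem _
    · intro c d hc hd
      rw [add_mul]
      exact add_mem hc hd
  have hdecomp : ∀ a : A, a = ∑ y, ∑ x, e y * (a * e x) := by
    intro a
    simp only [← Finset.mul_sum, ← Finset.sum_mul, he.complete, mul_one, one_mul]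
  have hS0 : ⊤ ≤ S ⊔ radical k A := by
    intro a _
    rw [hdecomp a]
    refine Submodule.sum_mem _ fun y _ => Submodule.sum_mem _ fun x _ => ?_
    by_cases hxy : x = y
    · subst hxy
      obtain ⟨c, hc⟩ := hdiag x a
      have hex : c • e x ∈ S := by
        have := hmemS (Finsupp.single (Quiver.Path.nil : Quiver.Path x x) c)
        rwa [hΨ] at this
      have := add_mem (Submodule.mem_sup_left hex : _ ∈ S ⊔ radical k A)
        (Submodule.mem_sup_right hc)
      rwa [add_sub_cancel] at this
    · exact Submodule.mem_sup_right (hoff x y hxy a)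
  have hS1 : radical k A ≤ (S ⊓ radical k A) ⊔ radical k A ^ 2 := by
    intro a ha
    rw [hdecomp a]
    refine Submodule.sum_mem _ fun y _ => Submodule.sum_mem _ fun x _ => ?_
    have hcor : e y * (a * e x) ∈ cornerOf k e x y (radical k A) := mem_cornerOf.2 ⟨a, ha, rfl⟩
    have hsq : cornerOf k e x y (radical k A ^ 2) ≤ radical k A ^ 2 := by
      intro b hb
      obtain ⟨m, hm, rfl⟩ := mem_cornerOf.1 hb
      exact mul_mem_radical_sq_left _ (mul_mem_radical_sq_right _ hm)
    rcases isEmpty_or_nonempty (x ⟶ y) with hemp | ⟨⟨β⟩⟩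
    · exact Submodule.mem_sup_right (hsq (hQ.cornerOf_le_of_isEmpty hcor))
    · obtain ⟨c, hc⟩ := hgen ⟨x, y, β⟩ _ hcor
      have hgS : c • g ⟨x, y, β⟩ ∈ S := by
        have := hmemS (Finsupp.single β.toPath c)
        rw [hΨ, show evalPath e g β.toPath = g ⟨x, y, β⟩ from hgr ⟨x, y, β⟩] at this
        exact this
      have := add_mem (Submodule.mem_sup_left ⟨hgS, Submodule.smul_mem _ c (hgrad _)⟩ :
        _ ∈ (S ⊓ radical k A) ⊔ radical k A ^ 2) (Submodule.mem_sup_right (hsq hc))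
      rwa [add_sub_cancel] at this
  -- Multiplying the approximation of the radical by itself gives one for each power, as `S` is
  -- closed under products and the errors fall one power deeper.
  have hSn : ∀ n, radical k A ^ (n + 1) ≤ (S ⊓ radical k A ^ (n + 1)) ⊔ radical k A ^ (n + 2) := by
    intro n
    induction n with
    | zero => rw [zero_add, pow_one]; exact hS1
    | succ n ih =>
      rw [pow_succ (radical k A) (n + 1)]
      refine (mul_le_mul' ih hS1).trans ?_
      rw [Submodule.sup_mul, Submodule.mul_sup]
      refine sup_le (sup_le ?_ ?_) ?_
      · refine le_sup_of_le_left (le_inf ?_ ?_)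
        · exact (mul_le_mul' inf_le_left inf_le_left).trans hSmul
        · exact mul_le_mul' inf_le_right inf_le_right
      · refine le_sup_of_le_right ?_
        refine (mul_le_mul' inf_le_right le_rfl).trans ?_
        rw [← pow_add]
      · refine le_sup_of_le_right ?_
        rw [pow_succ (radical k A) (n + 2)]
        refine mul_le_mul' le_rfl (sup_le inf_le_right ?_)
        rw [sq, Submodule.mul_le]
        exact fun a _ b hb => mul_mem_radical_left a hb
  have hStop : ∀ n, ⊤ ≤ S ⊔ radical k A ^ (n + 1) := by
    intro n
    induction n with
    | zero => rw [zero_add, pow_one]; exact hS0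
    | succ n ih =>
      exact ih.trans (sup_le le_sup_left ((hSn n).trans (sup_le_sup inf_le_left le_rfl)))
  have hS : ∀ a, a ∈ S := by
    intro a
    obtain ⟨n, hn⟩ := exists_radical_pow_eq_bot (k := k) (A := A)
    have := hStop n (Submodule.mem_top (x := a))
    rwa [pow_succ, hn, Submodule.bot_mul, sup_bot_eq] at this
  apply le_antisymm
  · rintro _ ⟨f, rfl⟩
    exact mem_cornerOf.2 ⟨Ψ x y f, Submodule.mem_top, by rw [hΨr, hΨl]⟩
  · intro a ha
    obtain ⟨b, -, rfl⟩ := mem_cornerOf.1 ha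
    refine Submodule.iSup_induction _
      (motive := fun b => e y * (b * e x) ∈ LinearMap.range (Ψ x y)) (hS b) ?_ ?_ ?_
    · rintro ⟨x', y'⟩ _ ⟨f, rfl⟩
      change e y * (Ψ x' y' f * e x) ∈ _
      by_cases hx : x' = x
      · subst hx
        by_cases hy : y' = y
        · subst hy
          rw [hΨr, hΨl]
          exact ⟨f, rfl⟩
        · rw [hΨr, ← hΨl f, ← mul_assoc, he.ortho (Ne.symm hy), zero_mul]
          exact zero_mem _
      · rw [← hΨr f, mul_assoc (Ψ x' y' f), he.ortho hx, mul_zero, mul_zero]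
        exact zero_mem _
    · rw [zero_mul, mul_zero]
      exact zero_mem _
    · intro c d hc hd
      rw [add_mul, mul_add]
      exact add_mem hc hd

end Gabriel

end

theorem proposition1p10 {k : Type w} [Field k] [CharZero k]
    {A : Type z} [Ring A] [Algebra k A] [FiniteDimensional k A]
    {V : Type u} [Fintype V] [Quiver.{v} V]
    (e : V → A)
    (hbasic : IsBasicAlgebra k A)
    (hconn : IsConnectedCategory k e)
    (hQ : IsOrdinaryQuiver k e)
    (hdb : NoDoubleBypass V) :
    Finite (HomotopyQuiver k e) ∧
      ∃! R : HomotopyQuiver k e, IsQuiverSource R := by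
  have hfin : ∀ x y : V, Finite (Quiver.Path x y) := hdb.finite_path hQ.finite_hom
  have hΓ : Finite (HomotopyQuiver k e) := by
    refine Set.Finite.subset (PathIdeal.finite_range_homotopyRel (k := k) hfin) ?_
    rintro R ⟨I, -, -, rfl⟩
    exact ⟨I, rfl⟩
  obtain ⟨I, hI, hIe⟩ := exists_isPresentationKernel hbasic hQ hdb hfin
  have : Nonempty (HomotopyQuiver k e) :=
    ⟨⟨HomotopyRel I, I, hI, nonempty_presentation_iff.2 hIe, rfl⟩⟩
  obtain ⟨R, hR⟩ := exists_isQuiverSource (k := k) (e := e) hdb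
  exact ⟨hΓ, R, hR, fun S hS => isQuiverSource_unique hdb hfin hQ.finite_hom hS hR⟩
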